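/- A packing of unit circles in the Euclidean plane is given by a set $C$ of centres such that the open unit discs around distinct points of $C$ are disjoint; let $D(C)$ be the union of the closed unit discs around the points of $C$. For a region $Q$, the density of the packing in $Q$ is $\operatorname{area}(D(C)\cap Q)/\operatorname{area}(Q)$. The packing has global density $\delta$ if for every point $x$ the density in the disc $B(x,R)$ tends to $\delta$ as $R\to\infty$; its upper density at $x$ is the $\limsup$ of the density in $B(x,R)$ as $R\to\infty$. The hexagonal packing is the one whose centres form the lattice $\mathbb Z(2,0)+\mathbb Z(1,\sqrt3)$. A building block is a compact set $P$ in the plane with non-empty interior and with boundary of area zero. A tiling by $P$ is a family of congruent copies of $P$ that cover the plane and have pairwise disjoint interiors. A Kepler building block is a building block that contains a closed unit disc, admits a tiling, and has the least area among all building blocks with these two properties. A number $\delta$ is a universal local density of a building block $P$ in the packing $C$ if there is a tiling by $P$ in each tile of which the packing has density $\delta$. Then: 1. The hexagonal packing is a packing of unit circles with global density $\pi/\sqrt{12}$, where $\sqrt{12}$ is the area of the regular hexagon circumscribed about a unit circle. 2. No packing of unit circles has a global density greater than $\pi/\sqrt{12}$: for every packing and every point $x$, the upper density at $x$ is at most $\pi/\sqrt{12}$.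 3. $\pi/\sqrt{12}$ is the maximum universal local density: no building block has, in any packing of unit circles, a universal local density greater than $\pi/\sqrt{12}$, and in the hexagonal packing $\pi/\sqrt{12}$ is a universal local density of the equilateral triangle of side $2$ with vertices at the centres $(0,0)$, $(2,0)$, $(1,\sqrt3)$, and of the regular hexagon circumscribed about the unit circle around the origin with two vertices on the second coordinate axis. 4. A convex set is a Kepler building block if and only if it is congruent to the regular hexagon circumscribed about a unit circle. 5. If a convex Kepler building block contains the closed unit disc with centre $c$, then in every tiling by this block the copies of $c$ form a set congruent to the set of centres of the hexagonal packing. -/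

import Mathlib

open Set Filter Topology MeasureTheory Metric

noncomputable section

namespace CirclePacking

/-- The Euclidean plane; `volume` on it is the area. -/
abbrev Plane : Type := EuclideanSpace ℝ (Fin 2)

/-- `C` is the set of centres of a packing of unit circles: distinct discs have no common
interior point. -/
def IsPacking (C : Set Plane) : Prop :=
  C.PairwiseDisjoint fun c => ball c 1

/-- The region covered by the unit discs centred at the points of `C`. -/
def covered (C : Set Plane) : Set Plane :=
  ⋃ c ∈ C, closedBall c 1

/-- The fraction of the area of the region `Q` that is covered by the discs. -/
def localDensity (C Q : Set Plane) : ℝ :=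
  volume.real (covered C ∩ Q) / volume.real Q

/-- The packing has global density `δ`: the density in the disc of radius `R` around any base
point tends to `δ`. -/
def HasGlobalDensity (C : Set Plane) (δ : ℝ) : Prop :=
  ∀ x : Plane, Tendsto (fun R : ℝ => localDensity C (ball x R)) atTop (𝓝 δ)

/-- The upper global density, computed from the base point `x`. It is defined for every packing
(the function is bounded, with values in `[0, 1]`). -/
def upperDensity (C : Set Plane) (x : Plane) : ℝ :=
  limsup (fun R : ℝ => localDensity C (ball x R)) atTop

/-- The centres of the hexagonal packing: the lattice spanned by `(2, 0)` and `(1, √3)`. -/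
def hexagonalPacking : Set Plane :=
  {p | ∃ m n : ℤ, p = (m : ℝ) • !₂[(2 : ℝ), 0] + (n : ℝ) • !₂[(1 : ℝ), √3]}

/-- The closed regular hexagon circumscribed about the unit circle around the origin. -/
def regularHexagon : Set Plane :=
  convexHull ℝ {!₂[(1 : ℝ), 1 / √3], !₂[(0 : ℝ), 2 / √3], !₂[(-1 : ℝ), 1 / √3],
    !₂[(-1 : ℝ), -(1 / √3)], !₂[(0 : ℝ), -(2 / √3)], !₂[(1 : ℝ), -(1 / √3)]}

/-- A closed equilateral triangle of side length `2`. -/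
def equilateralTriangle : Set Plane :=
  convexHull ℝ {!₂[(0 : ℝ), 0], !₂[(2 : ℝ), 0], !₂[(1 : ℝ), √3]}

/-- A building block: a compact region with an interior point and a boundary of area zero. -/
structure IsBuildingBlock (P : Set Plane) : Prop where
  isCompact : IsCompact P
  nonempty_interior : (interior P).Nonempty
  volume_frontier : volume (frontier P) = 0

/-- The congruent copies `g '' P`, `g ∈ G`, fill the plane without gaps or overlaps. -/
structure IsTiling (P : Set Plane) (G : Set (Plane ≃ᵢ Plane)) : Prop where
  covers : (⋃ g ∈ G, g '' P) = univ
  disjoint : G.PairwiseDisjoint fun g => interior (g '' P)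

/-- A building block that contains a unit disc and whose congruent copies tile the plane. -/
structure IsUnitDiscTile (P : Set Plane) : Prop where
  block : IsBuildingBlock P
  contains_disc : ∃ c : Plane, closedBall c 1 ⊆ P
  tiles : ∃ G : Set (Plane ≃ᵢ Plane), IsTiling P G

/-- A Kepler building block: it contains a unit disc, its copies tile the plane, and it has the
least area among all such blocks. -/
structure IsKeplerBlock (P : Set Plane) : Prop where
  tile : IsUnitDiscTile P
  least_area : ∀ Q : Set Plane, IsUnitDiscTile Q → volume P ≤ volume Q

/-- `δ` is a universal local density of the block `P` in the packing `C`: the plane can be filled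
by congruent copies of `P`, in each of which the discs have density `δ`. -/
def IsUniversalLocalDensity (C P : Set Plane) (δ : ℝ) : Prop :=
  IsBuildingBlock P ∧
    ∃ G : Set (Plane ≃ᵢ Plane), IsTiling P G ∧ ∀ g ∈ G, localDensity C (g '' P) = δ

end CirclePacking

end

open CirclePacking

noncomputable section

namespace CirclePacking

/-! Everything rests on one local estimate: in a packing, the Voronoi cell of a centre, truncated to
the disc of radius r = 2/√3, has area at least √12 (`IsPacking.sqrt_twelve_le_volume_cell`). A
neighbour at distance d in [2, 2r) removes a circular cap, whose sector has half-angle φ =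
arccos(d/2r) ≤ π/6. The sectors of different neighbours are disjoint (`sector_disjoint`), and the
fraction 1 - sin 2φ / 2φ of a sector occupied by its cap increases with φ. So the caps take at most
the fraction belonging to π/6 of the whole disc, which is exactly what the circumscribed disc of the
hexagon loses.

Truncated cells are pairwise disjoint, so counting them in B(x, R), with errors only in a boundary
layer, gives the density bound. The same counting with tiles shows that a universal local density is
a global density (`hasGlobalDensity_of_isUniversalLocalDensity`) and that a tile containing a unit
disc has area at least √12 (`IsTiling.le_volume_real`).

The estimate is stable: if fewer than six neighbours are at distance below some d > 2, the cell
exceeds √12 by a fixed amount (`exists_add_le_volume_cell`). Hence a tiling by a Kepler block has,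
for each such d, a tile with six neighbours that near. Pulling these configurations back to the
block and passing to a limit yields six discs that touch the inscribed disc and avoid the interior
of the block (`IsKeplerBlock.exists_six_touching`). A convex block then lies on the near side of all
six perpendicular bisectors, that is, in a regular hexagon; by area it is the hexagon.

In a tiling by such hexagons the discs of radius r around the centres cover the plane. Where two
boundary circles meet and one can leave both discs, a third disc is needed (`exists_third`), and the
identity `sum_dist_sq_eq` forces the three centres into an equilateral triangle of side 2. Such
triangles propagate through the whole lattice, so no assumption that tiles meet edge to edge is
needed. -/

/-- The circumradius of the regular hexagon of inradius one. -/
def hexRadius : ℝ := 2 / √3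

theorem hexRadius_pos : 0 < hexRadius := by unfold hexRadius; positivity

theorem hexRadius_sq : hexRadius ^ 2 = 4 / 3 := by
  unfold hexRadius
  rw [div_pow, Real.sq_sqrt (by norm_num)]; norm_num

theorem hexRadius_lt : hexRadius < 6 / 5 := by
  nlinarith [hexRadius_sq, hexRadius_pos]

/-! ### Isometry invariance of area; areas of circular sectors and caps -/

/-- Area is the normalised two-dimensional Hausdorff measure, which depends only on distances; no
linearity of `e` is needed. -/
theorem volume_image_isometryEquiv (e : Plane ≃ᵢ Plane) (s : Set Plane) :
    volume (e '' s) = volume s := by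
  have h := e.isometry.euclideanHausdorffMeasure_image (d := 2) s
  rwa [EuclideanSpace.euclideanHausdorffMeasure_eq_volume] at h

theorem volume_real_image_isometryEquiv (e : Plane ≃ᵢ Plane) (s : Set Plane) :
    volume.real (e '' s) = volume.real s := by
  simp [measureReal_def, volume_image_isometryEquiv]

theorem volume_preimage_complex (e : ℂ ≃ᵢ Plane) (s : Set Plane) :
    volume (e ⁻¹' s) = volume s := by
  have h := e.isometry.euclideanHausdorffMeasure_preimage (d := 2) s
  rw [EuclideanSpace.euclideanHausdorffMeasure_eq_volume, e.range_eq_univ, inter_univ] at h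
  have h2 := InnerProductSpace.euclideanHausdorffMeasure_eq_volume (V := ℂ)
  rw [Complex.finrank_real_complex] at h2
  rwa [h2] at h

theorem volume_real_ball (x : Plane) {r : ℝ} (hr : 0 ≤ r) :
    volume.real (ball x r) = Real.pi * r ^ 2 := by
  rw [measureReal_def, EuclideanSpace.volume_ball_fin_two, ← ENNReal.ofReal_pow hr,
    ← ENNReal.ofReal_mul (by positivity), ENNReal.toReal_ofReal (by positivity), mul_comm]

theorem volume_complex_eq_prod (s : Set (ℝ × ℝ)) :
    volume {z : ℂ | (z.re, z.im) ∈ s} = volume s :=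
  Complex.volume_preserving_equiv_real_prod.measure_preimage_equiv s

theorem cos_lt_cos_iff_abs_lt {a b : ℝ} (ha : |a| ≤ Real.pi) (hb : 0 ≤ b) (hb' : b ≤ Real.pi) :
    Real.cos b < Real.cos a ↔ |a| < b := by
  rw [← Real.cos_abs a]
  exact Real.strictAntiOn_cos.lt_iff_gt ⟨hb, hb'⟩ ⟨abs_nonneg a, ha⟩

/-- The second condition says |arg z| < φ, so in polar coordinates the set is a rectangle. -/
theorem volume_sector {r φ : ℝ} (hr : 0 ≤ r) (h0 : 0 ≤ φ) (hφ : φ ≤ Real.pi) :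
    volume {z : ℂ | ‖z‖ < r ∧ Real.cos φ * ‖z‖ < z.re} = ENNReal.ofReal (r ^ 2 * φ) := by
  set S := {z : ℂ | ‖z‖ < r ∧ Real.cos φ * ‖z‖ < z.re} with hS
  have hSm : MeasurableSet S := by
    apply IsOpen.measurableSet
    exact (isOpen_lt continuous_norm continuous_const).inter
      (isOpen_lt (continuous_const.mul continuous_norm) Complex.continuous_re)
  rw [← lintegral_indicator_one hSm, ← Complex.lintegral_comp_polarCoord_symm]
  have key : ∀ p ∈ polarCoord.target,
      ENNReal.ofReal p.1 • S.indicator (1 : ℂ → ENNReal) (Complex.polarCoord.symm p) =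
      (Ioo 0 r ×ˢ Ioo (-φ) φ).indicator (fun p => ENNReal.ofReal p.1) p := by
    rintro ⟨a, t⟩ ⟨ha, ht⟩
    simp only [mem_Ioi, mem_Ioo] at ha ht
    have hn : ‖Complex.polarCoord.symm (a, t)‖ = a := by
      rw [Complex.norm_polarCoord_symm, abs_of_pos ha]
    have hre : (Complex.polarCoord.symm (a, t)).re = a * Real.cos t := by
      simp [Complex.cos_ofReal_re, Complex.sin_ofReal_im]
    have hiff : Complex.polarCoord.symm (a, t) ∈ S ↔ (a, t) ∈ Ioo 0 r ×ˢ Ioo (-φ) φ := by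
      rw [hS, mem_ofPred_eq, hn, hre, mul_comm, mul_lt_mul_iff_right₀ ha,
        cos_lt_cos_iff_abs_lt (abs_le.2 ⟨ht.1.le, ht.2.le⟩) h0 hφ, abs_lt]
      simp [ha]
    by_cases hm : (a, t) ∈ Ioo 0 r ×ˢ Ioo (-φ) φ
    · rw [indicator_of_mem hm, indicator_of_mem (hiff.2 hm)]; simp
    · rw [indicator_of_notMem hm, indicator_of_notMem (fun h => hm (hiff.1 h))]; simp
  have hmeas : MeasurableSet polarCoord.target := polarCoord.open_target.measurableSet
  rw [setLIntegral_congr_fun hmeas key,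
    lintegral_indicator (measurableSet_Ioo.prod measurableSet_Ioo),
    Measure.restrict_restrict (measurableSet_Ioo.prod measurableSet_Ioo)]
  have hsub : Ioo 0 r ×ˢ Ioo (-φ) φ ∩ polarCoord.target = Ioo 0 r ×ˢ Ioo (-φ) φ := by
    apply inter_eq_left.2
    exact prod_mono (fun x hx => hx.1) (Ioo_subset_Ioo (by linarith) hφ)
  rw [hsub, Measure.volume_eq_prod, ← Measure.prod_restrict,
    lintegral_prod _ (by fun_prop)]
  simp only [lintegral_const, Measure.restrict_apply MeasurableSet.univ, univ_inter,
    Real.volume_Ioo]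
  rw [lintegral_mul_const _ (by fun_prop),
    ← ofReal_integral_eq_lintegral_ofReal, ← integral_Ioc_eq_integral_Ioo,
    ← intervalIntegral.integral_of_le hr, integral_id, ← ENNReal.ofReal_mul (by nlinarith)]
  · congr 1; ring
  · exact (continuous_id.integrableOn_Icc).mono_set Ioo_subset_Icc_self
  · filter_upwards [self_mem_ae_restrict measurableSet_Ioo] with x hx using hx.1.le

theorem volume_triangle {h m : ℝ} (hh : 0 ≤ h) (hm : 0 ≤ m) :
    volume {z : ℂ | (z.re ∈ Ioo 0 h) ∧ z.im ∈ Ioo (-(m * z.re)) (m * z.re)} =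
      ENNReal.ofReal (m * h ^ 2) := by
  have := volume_complex_eq_prod (regionBetween (fun x => -(m * x)) (fun x => m * x) (Ioo 0 h))
  unfold regionBetween at this
  simp only [mem_ofPred_eq] at this
  rw [this]
  have h2 := volume_regionBetween_eq_integral (μ := (volume : Measure ℝ))
    (f := fun x => -(m * x)) (g := fun x => m * x) (s := Ioo 0 h)
    ((Continuous.integrableOn_Icc (by fun_prop)).mono_set Ioo_subset_Icc_self)
    ((Continuous.integrableOn_Icc (by fun_prop)).mono_set Ioo_subset_Icc_self)
    measurableSet_Ioo (fun x hx => by nlinarith [mul_nonneg hm hx.1.le])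
  unfold regionBetween at h2
  rw [Measure.volume_eq_prod, h2, ← integral_Ioc_eq_integral_Ioo,
    ← intervalIntegral.integral_of_le hh]
  congr 1
  have : ∀ x : ℝ, ((fun x => m * x) - fun x => -(m * x)) x = (2 * m) * x := by
    intro x; simp; ring
  simp_rw [this]
  rw [intervalIntegral.integral_const_mul, integral_id]; ring

/-- The cap is contained in the sector minus the triangle under its chord. Only the upper bound is
needed, so boundary points require no care. -/
theorem volume_cap_le {r φ : ℝ} (hr : 0 < r) (h0 : 0 < φ) (hφ : φ < Real.pi / 2) :
    volume.real {z : ℂ | ‖z‖ < r ∧ r * Real.cos φ ≤ z.re} ≤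
      r ^ 2 * φ - r ^ 2 * (Real.sin φ * Real.cos φ) := by
  have hc : 0 < Real.cos φ := Real.cos_pos_of_mem_Ioo ⟨by linarith, hφ⟩
  have hs : 0 < Real.sin φ := Real.sin_pos_of_pos_of_lt_pi h0 (by linarith [Real.pi_pos])
  set S := {z : ℂ | ‖z‖ < r ∧ Real.cos φ * ‖z‖ < z.re}
  set T := {z : ℂ | (z.re ∈ Ioo 0 (r * Real.cos φ)) ∧
    z.im ∈ Ioo (-(Real.tan φ * z.re)) (Real.tan φ * z.re)} with hT
  have hST : T ⊆ S := by
    rintro z ⟨⟨hz0, hz1⟩, hz2, hz3⟩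
    have h1 : Real.tan φ * Real.cos φ = Real.sin φ := Real.tan_mul_cos hc.ne'
    have habs : |z.im * Real.cos φ| < Real.sin φ * z.re := by
      rw [abs_lt]
      constructor <;> nlinarith
    have h2 : (Real.cos φ * ‖z‖) ^ 2 < z.re ^ 2 := by
      rw [mul_pow, ← Complex.normSq_eq_norm_sq, Complex.normSq_apply]
      have := sq_lt_sq' (by linarith [abs_nonneg (z.im * Real.cos φ)]) habs
      rw [sq_abs] at this
      nlinarith [Real.sin_sq_add_cos_sq φ]
    have h3 : Real.cos φ * ‖z‖ < z.re := lt_of_pow_lt_pow_left₀ 2 hz0.le h2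
    refine ⟨?_, h3⟩
    have : Real.cos φ * ‖z‖ < Real.cos φ * r := by linarith
    exact lt_of_mul_lt_mul_left this hc.le
  have hTm : MeasurableSet T := by
    apply IsOpen.measurableSet
    have h1 := Complex.continuous_re
    have h2 := Complex.continuous_im
    have : T = ({z | 0 < z.re} ∩ {z | z.re < r * Real.cos φ}) ∩
      ({z | -(Real.tan φ * z.re) < z.im} ∩ {z | z.im < Real.tan φ * z.re}) := rfl
    rw [this]
    exact ((isOpen_lt (by fun_prop) (by fun_prop)).inter
      (isOpen_lt (by fun_prop) (by fun_prop))).inter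
      ((isOpen_lt (by fun_prop) (by fun_prop)).inter (isOpen_lt (by fun_prop) (by fun_prop)))
  have hSv := volume_sector hr.le h0.le (by linarith [Real.pi_pos] : φ ≤ Real.pi)
  have htan : 0 ≤ Real.tan φ := by rw [Real.tan_eq_sin_div_cos]; positivity
  have hTv := volume_triangle (mul_pos hr hc).le htan
  have hfin : volume S ≠ ⊤ := by rw [hSv]; exact ENNReal.ofReal_ne_top
  have hd := measureReal_sdiff hST hTm hfin
  have hsub : {z : ℂ | ‖z‖ < r ∧ r * Real.cos φ ≤ z.re} ⊆ S \ T := by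
    rintro z ⟨hz1, hz2⟩
    refine ⟨⟨hz1, ?_⟩, fun h => absurd h.1.2 (not_lt.2 hz2)⟩
    nlinarith
  refine (measureReal_mono hsub (measure_ne_top_of_subset sdiff_subset hfin)).trans ?_
  rw [hd, measureReal_def, hSv, measureReal_def, hTv, ENNReal.toReal_ofReal (by positivity),
    ENNReal.toReal_ofReal (by positivity)]
  apply le_of_eq
  rw [Real.tan_eq_sin_div_cos]
  field_simp

/-- Concavity of the sine: its graph over [0, 2b] lies above the chord from the origin. This is the
monotonicity of sin(2x)/x. -/
theorem sin_two_mul_ge {φ b : ℝ} (h0 : 0 ≤ φ) (hb : φ ≤ b) (hb0 : 0 < b) (hbπ : b ≤ Real.pi / 2) :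
    φ * (Real.sin (2 * b) / b) ≤ Real.sin (2 * φ) := by
  have h := strictConcaveOn_sin_Icc.concaveOn.2
    (show (0 : ℝ) ∈ Icc 0 Real.pi from ⟨le_rfl, Real.pi_pos.le⟩)
    (show 2 * b ∈ Icc 0 Real.pi from ⟨by linarith, by linarith⟩)
    (show 0 ≤ 1 - φ / b by rw [sub_nonneg, div_le_one hb0]; exact hb)
    (show 0 ≤ φ / b by positivity) (by ring)
  simp only [smul_eq_mul, mul_zero, zero_add, Real.sin_zero] at h
  have e : φ / b * (2 * b) = 2 * φ := by field_simp
  rw [e] at h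
  calc _ = φ / b * Real.sin (2 * b) := by ring
    _ ≤ _ := h

theorem sin_two_mul_div_lt {a b : ℝ} (h0 : 0 < a) (hab : a < b) (hbπ : b ≤ Real.pi / 2) :
    Real.sin (2 * b) / b < Real.sin (2 * a) / a := by
  have hb0 : 0 < b := h0.trans hab
  have h := strictConcaveOn_sin_Icc.2
    (show (0 : ℝ) ∈ Icc 0 Real.pi from ⟨le_rfl, Real.pi_pos.le⟩)
    (show 2 * b ∈ Icc 0 Real.pi from ⟨by linarith, by linarith⟩) (by linarith)
    (show 0 < 1 - a / b by rw [sub_pos, div_lt_one hb0]; exact hab)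
    (show 0 < a / b by positivity) (by ring)
  simp only [smul_eq_mul, mul_zero, zero_add, Real.sin_zero] at h
  have e : a / b * (2 * b) = 2 * a := by field_simp
  rw [e] at h
  rw [lt_div_iff₀ h0]
  calc _ = a / b * Real.sin (2 * b) := by ring
    _ < _ := h

/-! ### The sector and the cap cut off by a neighbouring centre -/

/-- The isometry from the complex plane which rotates by `u` and moves the origin to `p`. -/
def complexFrame (p : Plane) (u : Circle) : ℂ ≃ᵢ Plane :=
  (rotation u).toIsometryEquiv.trans
    (Complex.orthonormalBasisOneI.repr.toIsometryEquiv.trans (IsometryEquiv.vaddConst p))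

theorem complexFrame_apply (p : Plane) (u : Circle) (z : ℂ) :
    complexFrame p u z = Complex.orthonormalBasisOneI.repr (u * z) + p := rfl

theorem complexFrame_zero (p : Plane) (u : Circle) : complexFrame p u 0 = p := by
  simp [complexFrame_apply]

theorem exists_complexFrame {p q : Plane} (h : p ≠ q) :
    ∃ u : Circle, complexFrame p u (dist p q) = q := by
  set w := Complex.orthonormalBasisOneI.repr.symm (q - p) with hw
  have hn : ‖w‖ = dist p q := by
    rw [hw, LinearIsometryEquiv.norm_map, dist_eq_norm', ]
  have h0 : (dist p q : ℂ) ≠ 0 := by exact_mod_cast (dist_pos.2 h).ne'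
  have hm : w / dist p q ∈ Submonoid.unitSphere ℂ := mem_sphere_zero_iff_norm.2 (by
    rw [norm_div, hn, Complex.norm_real, Real.norm_of_nonneg dist_nonneg,
      div_self (dist_pos.2 h).ne'])
  obtain ⟨u, hu⟩ : ∃ u : Circle, (u : ℂ) = w / dist p q := ⟨⟨_, hm⟩, rfl⟩
  refine ⟨u, ?_⟩
  rw [complexFrame_apply, hu, div_mul_cancel₀ _ h0, hw,
    LinearIsometryEquiv.apply_symm_apply, sub_add_cancel]

/-- The part of the disc of radius `hexRadius` around `c` that is at least as close to `c'`. -/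
def cap (c c' : Plane) : Set Plane :=
  {p | dist p c < hexRadius ∧ dist p c' ≤ dist p c}

/-- The circular sector spanned by `cap c c'`. -/
def sector (c c' : Plane) : Set Plane :=
  {p | dist p c < hexRadius ∧ dist c c' ^ 2 * dist p c <
    hexRadius * (dist p c ^ 2 + dist c c' ^ 2 - dist p c' ^ 2)}

theorem measurableSet_cap (c c' : Plane) : MeasurableSet (cap c c') :=
  (isOpen_lt (f := fun p => dist p c) (g := fun _ => hexRadius)
    (by fun_prop) (by fun_prop)).measurableSet.inter
    (isClosed_le (f := fun p => dist p c') (g := fun p => dist p c)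
    (by fun_prop) (by fun_prop)).measurableSet

theorem measurableSet_sector (c c' : Plane) : MeasurableSet (sector c c') :=
  ((isOpen_lt (f := fun p => dist p c) (g := fun _ => hexRadius)
    (by fun_prop) (by fun_prop)).inter
    (isOpen_lt (f := fun p => dist c c' ^ 2 * dist p c)
      (g := fun p => hexRadius * (dist p c ^ 2 + dist c c' ^ 2 - dist p c' ^ 2))
    (by fun_prop) (by fun_prop))).measurableSet

/-- Half the angle of `sector c c'` when `dist c c' = d`. -/
def halfAngle (d : ℝ) : ℝ := Real.arccos (d / (2 * hexRadius))

theorem cos_halfAngle {d : ℝ} (h0 : 0 ≤ d) (hd : d < 2 * hexRadius) :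
    Real.cos (halfAngle d) = d / (2 * hexRadius) := by
  have := hexRadius_pos
  apply Real.cos_arccos
  · linarith [show 0 ≤ d / (2 * hexRadius) by positivity]
  · rw [div_le_one (by positivity)]; exact hd.le

theorem halfAngle_pos {d : ℝ} (hd : d < 2 * hexRadius) : 0 < halfAngle d := by
  have := hexRadius_pos
  rw [halfAngle, Real.arccos_pos, div_lt_one (by positivity)]; exact hd

theorem halfAngle_le {d d' : ℝ} (h : d ≤ d') : halfAngle d' ≤ halfAngle d := by
  have := hexRadius_pos
  exact Real.antitone_arccos (by gcongr)

theorem halfAngle_two : halfAngle 2 = Real.pi / 6 := by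
  have h : (2 : ℝ) / (2 * hexRadius) = Real.cos (Real.pi / 6) := by
    rw [Real.cos_pi_div_six, hexRadius]; field_simp
  rw [halfAngle, h, Real.arccos_cos] <;> linarith [Real.pi_pos]

theorem halfAngle_le_pi_div_six {d : ℝ} (h : 2 ≤ d) : halfAngle d ≤ Real.pi / 6 :=
  halfAngle_two ▸ halfAngle_le h

theorem halfAngle_lt {d : ℝ} (h : 2 < d) (hd : d < 2 * hexRadius) : halfAngle d < Real.pi / 6 := by
  rw [← halfAngle_two]
  have := hexRadius_pos
  apply Real.strictAntiOn_arccos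
  · exact ⟨by linarith [show 0 ≤ 2 / (2 * hexRadius) by positivity],
      by rw [div_le_one (by positivity)]; linarith⟩
  · exact ⟨by linarith [show 0 ≤ d / (2 * hexRadius) by positivity],
      by rw [div_le_one (by positivity)]; exact hd.le⟩
  · gcongr

theorem norm_sub_ofReal_sq (z : ℂ) (d : ℝ) : ‖z - d‖ ^ 2 = ‖z‖ ^ 2 - 2 * d * z.re + d ^ 2 := by
  rw [← Complex.normSq_eq_norm_sq, ← Complex.normSq_eq_norm_sq, Complex.normSq_apply,
    Complex.normSq_apply]
  simp; ring

/-- In a frame with `c` at the origin and `c'` on the positive real axis, the law of cosines turns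
the inequality defining `sector` into d‖z‖ < 2r Re z, the form treated in `volume_sector`. -/
theorem volume_real_sector {c c' : Plane} (hd : 2 ≤ dist c c') (hd' : dist c c' < 2 * hexRadius) :
    volume.real (sector c c') = 4 / 3 * halfAngle (dist c c') := by
  have hr := hexRadius_pos
  obtain ⟨u, hu⟩ := exists_complexFrame (p := c) (q := c') (dist_pos.1 (by linarith))
  have hpi : halfAngle (dist c c') ≤ Real.pi := by
    linarith [halfAngle_le_pi_div_six hd, Real.pi_pos]
  rw [measureReal_def, ← volume_preimage_complex (complexFrame c u)]
  have : complexFrame c u ⁻¹' sector c c' =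
      {z : ℂ | ‖z‖ < hexRadius ∧ Real.cos (halfAngle (dist c c')) * ‖z‖ < z.re} := by
    ext z
    have h1 : dist (complexFrame c u z) c = ‖z‖ := by
      rw [← dist_zero_right z, ← (complexFrame c u).dist_eq z 0, complexFrame_zero]
    have h2 : dist (complexFrame c u z) c' = ‖z - dist c c'‖ := by
      rw [← dist_eq_norm, ← (complexFrame c u).dist_eq z, hu]
    simp only [mem_preimage, sector, mem_ofPred_eq]
    rw [h1, h2, norm_sub_ofReal_sq, cos_halfAngle (by linarith) hd', div_mul_eq_mul_div,
      div_lt_iff₀ (by positivity)]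
    have hd0 : 0 < dist c c' := by linarith
    have : dist c c' ^ 2 * ‖z‖ < hexRadius * (‖z‖ ^ 2 + dist c c' ^ 2 -
        (‖z‖ ^ 2 - 2 * dist c c' * z.re + dist c c' ^ 2)) ↔
        dist c c' * ‖z‖ < z.re * (2 * hexRadius) := by
      rw [← mul_lt_mul_iff_right₀ (a := dist c c') (b := dist c c' * ‖z‖) hd0]
      constructor <;> intro h <;> linarith
    rw [this]
  rw [this, volume_sector hr.le (halfAngle_pos hd').le hpi, hexRadius_sq, ENNReal.toReal_ofReal]
  have := halfAngle_pos hd'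
  positivity

theorem volume_real_cap_le {c c' : Plane} (hd : 2 ≤ dist c c') (hd' : dist c c' < 2 * hexRadius) :
    volume.real (cap c c') ≤
      4 / 3 * halfAngle (dist c c') - 2 / 3 * Real.sin (2 * halfAngle (dist c c')) := by
  have hr := hexRadius_pos
  obtain ⟨u, hu⟩ := exists_complexFrame (p := c) (q := c') (dist_pos.1 (by linarith))
  have hpi : halfAngle (dist c c') < Real.pi / 2 := by
    linarith [halfAngle_le_pi_div_six hd, Real.pi_pos]
  rw [measureReal_def, ← volume_preimage_complex (complexFrame c u)]
  have : complexFrame c u ⁻¹' cap c c' =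
      {z : ℂ | ‖z‖ < hexRadius ∧ hexRadius * Real.cos (halfAngle (dist c c')) ≤ z.re} := by
    ext z
    have h1 : dist (complexFrame c u z) c = ‖z‖ := by
      rw [← dist_zero_right z, ← (complexFrame c u).dist_eq z 0, complexFrame_zero]
    have h2 : dist (complexFrame c u z) c' = ‖z - dist c c'‖ := by
      rw [← dist_eq_norm, ← (complexFrame c u).dist_eq z, hu]
    simp only [mem_preimage, cap, mem_ofPred_eq]
    rw [h1, h2, cos_halfAngle (by linarith) hd', ← sq_le_sq₀ (norm_nonneg _) (norm_nonneg _),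
      norm_sub_ofReal_sq]
    have hd0 : 0 < dist c c' := by linarith
    have e : hexRadius * (dist c c' / (2 * hexRadius)) = dist c c' / 2 := by field_simp
    rw [e]
    have : ‖z‖ ^ 2 - 2 * dist c c' * z.re + dist c c' ^ 2 ≤ ‖z‖ ^ 2 ↔ dist c c' / 2 ≤ z.re := by
      constructor
      · intro h
        have : dist c c' * (dist c c' / 2) ≤ dist c c' * z.re := by linarith
        exact le_of_mul_le_mul_left this hd0
      · intro h
        nlinarith [mul_le_mul_of_nonneg_left h hd0.le]
    rw [this]
  rw [this, ← measureReal_def]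
  refine (volume_cap_le hr (halfAngle_pos hd') hpi).trans (le_of_eq ?_)
  rw [hexRadius_sq, Real.sin_two_mul]; ring

/-- The fraction of a circular sector of half-angle `b` that its cap occupies. -/
def capRatio (b : ℝ) : ℝ := 1 - Real.sin (2 * b) / b / 2

/-- Since the ratio increases with the half-angle, any upper bound `b` for the half-angle gives a
valid ratio. -/
theorem volume_real_cap_le_capRatio_mul {c c' : Plane} {b : ℝ} (hd : 2 ≤ dist c c')
    (hd' : dist c c' < 2 * hexRadius) (hb : halfAngle (dist c c') ≤ b) (hb' : b ≤ Real.pi / 2) :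
    volume.real (cap c c') ≤ capRatio b * volume.real (sector c c') := by
  have h0 := halfAngle_pos hd'
  have h1 := sin_two_mul_ge h0.le hb (h0.trans_le hb) hb'
  rw [volume_real_sector hd hd', capRatio]
  linarith [volume_real_cap_le hd hd']

theorem capRatio_lt {a b : ℝ} (h0 : 0 < a) (hab : a < b) (hbπ : b ≤ Real.pi / 2) :
    capRatio a < capRatio b := by
  have := sin_two_mul_div_lt h0 hab hbπ
  unfold capRatio; linarith

theorem capRatio_nonneg {b : ℝ} (h0 : 0 < b) : 0 ≤ capRatio b := by
  have h := Real.sin_le (x := 2 * b) (by linarith)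
  have : Real.sin (2 * b) / b / 2 ≤ 1 := by
    rw [div_div, div_le_one (by positivity)]; linarith
  unfold capRatio; linarith

theorem sqrt_twelve : √12 = 2 * √3 := by
  rw [show (12 : ℝ) = 2 ^ 2 * 3 by norm_num, Real.sqrt_mul (by norm_num),
    Real.sqrt_sq (by norm_num)]

/-- The extremal case: six sectors of half-angle π/6 fill the disc of area 4π/3, and removing their
caps leaves the regular hexagon. -/
theorem capRatio_pi_div_six : Real.pi * (4 / 3) * (1 - capRatio (Real.pi / 6)) = √12 := by
  have := Real.pi_pos
  rw [capRatio, show 2 * (Real.pi / 6) = Real.pi / 3 by ring, Real.sin_pi_div_three, sqrt_twelve]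
  field_simp
  ring

/-- Leibniz's identity for three points. It bounds the sides of a triangle by the distances from
`p`, with equality only when `p` is the centroid; it serves both the disjointness of sectors and the
rigidity of coverings. -/
theorem sum_dist_sq_eq (p a b c : Plane) :
    dist a b ^ 2 + dist b c ^ 2 + dist c a ^ 2 =
      3 * (dist p a ^ 2 + dist p b ^ 2 + dist p c ^ 2) - ‖(a - p) + (b - p) + (c - p)‖ ^ 2 := by
  simp only [EuclideanSpace.dist_eq, EuclideanSpace.norm_eq, Fin.sum_univ_two]
  repeat rw [Real.sq_sqrt (by positivity)]
  simp only [Real.dist_eq, Real.norm_eq_abs, sq_abs, PiLp.add_apply, PiLp.sub_apply]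
  ring

/-- Push a common point radially to the circle of radius r around `c`. The new point has distance r
from `c` and less than r from `a` and `b`, so by `sum_dist_sq_eq` the squared sides of the triangle
sum to less than 3 · 3 · 4/3 = 12, whereas each side is at least 2. -/
theorem sector_disjoint {c a b : Plane} (ha : 2 ≤ dist c a) (hb : 2 ≤ dist c b)
    (hab : 2 ≤ dist a b) : Disjoint (sector c a) (sector c b) := by
  rw [Set.disjoint_left]
  rintro p ⟨hp1, hp2⟩ ⟨-, hp3⟩
  have hr := hexRadius_pos
  -- The apex is not in the sector: there the defining inequality reads 0 < 0.
  have hpc : 0 < dist p c := by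
    rcases (dist_nonneg (x := p) (y := c)).eq_or_lt with h | h
    · rw [← h] at hp2
      have : p = c := dist_eq_zero.1 h.symm
      subst this
      simp at hp2
    · exact h
  -- the point of the circle of radius `hexRadius` in direction `p`
  set t := hexRadius / dist p c with ht
  have ht0 : 0 < t := by positivity
  have htp : t * dist p c = hexRadius := by rw [ht]; field_simp
  set q : Plane := c + t • (p - c) with hq
  have hqc : dist q c ^ 2 = hexRadius ^ 2 := by
    rw [dist_eq_norm, hq, add_sub_cancel_left, norm_smul, Real.norm_of_nonneg ht0.le,
      ← dist_eq_norm, htp]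
  have key : ∀ x : Plane, dist c x ^ 2 * dist p c <
      hexRadius * (dist p c ^ 2 + dist c x ^ 2 - dist p x ^ 2) → dist q x ^ 2 < hexRadius ^ 2 := by
    intro x hx
    have e : dist q x ^ 2 =
        dist q c ^ 2 + dist c x ^ 2 - t * (dist p c ^ 2 + dist c x ^ 2 - dist p x ^ 2) := by
      simp only [hq, EuclideanSpace.dist_eq, Fin.sum_univ_two]
      repeat rw [Real.sq_sqrt (by positivity)]
      simp only [Real.dist_eq, sq_abs, PiLp.add_apply, PiLp.sub_apply, PiLp.smul_apply,
        smul_eq_mul]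
      ring
    rw [e, hqc]
    have : t * (dist p c ^ 2 + dist c x ^ 2 - dist p x ^ 2) * dist p c =
      hexRadius * (dist p c ^ 2 + dist c x ^ 2 - dist p x ^ 2) := by
      rw [← htp]; ring
    rw [← this] at hx
    linarith [lt_of_mul_lt_mul_right hx hpc.le]
  have h1 := key a hp2
  have h2 := key b hp3
  have h := sum_dist_sq_eq q c a b
  rw [hexRadius_sq] at h1 h2 hqc
  rw [dist_comm b c] at h
  nlinarith [sq_nonneg ‖(c - q) + (a - q) + (b - q)‖]

/-! ### Packings and truncated Voronoi cells -/

theorem IsPacking.two_le_dist {C : Set Plane} (hC : IsPacking C) {c c' : Plane} (hc : c ∈ C)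
    (hc' : c' ∈ C) (h : c ≠ c') : 2 ≤ dist c c' := by
  have := (disjoint_ball_ball_iff one_pos one_pos).1 (hC hc hc' h)
  linarith

theorem isPacking_of_two_le_dist {C : Set Plane}
    (h : ∀ c ∈ C, ∀ c' ∈ C, c ≠ c' → 2 ≤ dist c c') : IsPacking C := fun c hc c' hc' hne =>
  (disjoint_ball_ball_iff one_pos one_pos).2 (by linarith [h c hc c' hc' hne])

/-- The common volume count, applied to unit discs, cells and tiles. Almost disjointness is allowed
because tiles share boundary points. -/
theorem finite_and_mul_ncard_le {ι : Type*} {S : Set ι} {A : ι → Set Plane} {v : ℝ} (hv : 0 < v)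
    (hm : ∀ i ∈ S, NullMeasurableSet (A i)) (hd : S.Pairwise (Function.onFun (AEDisjoint volume) A))
    (hA : ∀ i ∈ S, v ≤ volume.real (A i)) {B : Set Plane} (hB : volume B ≠ ⊤)
    (hsub : ∀ i ∈ S, A i ⊆ B) : S.Finite ∧ v * S.ncard ≤ volume.real B := by
  have hfin : S.Finite := by
    have := Measure.finite_const_le_meas_of_disjoint_iUnion₀ (volume : Measure Plane)
      (ENNReal.ofReal_pos.2 hv) (As := fun i : S => A i) (fun i => hm i i.2)
      (fun i j hij => hd i.2 j.2 (fun h => hij (Subtype.ext h)))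
      (measure_ne_top_of_subset (iUnion_subset fun i => hsub i i.2) hB)
    have hu : {i : S | ENNReal.ofReal v ≤ volume (A i)} = univ := by
      refine eq_univ_of_forall fun i => ?_
      exact (ENNReal.ofReal_le_iff_le_toReal
        (measure_ne_top_of_subset (hsub i i.2) hB)).2 (hA i i.2)
    rw [hu, finite_univ_iff] at this
    exact S.toFinite
  refine ⟨hfin, ?_⟩
  have h1 : volume.real (⋃ i ∈ hfin.toFinset, A i) = ∑ i ∈ hfin.toFinset, volume.real (A i) :=
    measureReal_biUnion_finset₀ (by simpa using hd) (fun i hi => hm i (by simpa using hi))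
      (fun i hi => measure_ne_top_of_subset (hsub i (by simpa using hi)) hB)
  have h2 : volume.real (⋃ i ∈ hfin.toFinset, A i) ≤ volume.real B :=
    measureReal_mono (iUnion₂_subset fun i hi => hsub i (by simpa using hi)) hB
  have h3 : (hfin.toFinset.card : ℝ) * v ≤ ∑ i ∈ hfin.toFinset, volume.real (A i) := by
    rw [← nsmul_eq_mul]
    exact Finset.card_nsmul_le_sum _ _ _ fun i hi => hA i (by simpa using hi)
  rw [ncard_eq_toFinset_card S hfin]
  linarith

theorem IsPacking.finite_inter_ball {C : Set Plane} (hC : IsPacking C) (x : Plane) (r : ℝ) :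
    (C ∩ ball x r).Finite := by
  refine (finite_and_mul_ncard_le (v := Real.pi) (B := ball x (r + 1)) (A := fun c => ball c 1)
    Real.pi_pos (fun c _ => measurableSet_ball.nullMeasurableSet) ?_ ?_ measure_ball_lt_top.ne
    ?_).1
  · exact fun c hc c' hc' h => (hC hc.1 hc'.1 h).aedisjoint
  · intro c _
    rw [volume_real_ball c zero_le_one]; simp
  · rintro c ⟨-, hc⟩
    apply ball_subset_ball'
    rw [mem_ball] at hc; linarith

/-- The centres close enough to `c` to cut off a part of the disc of radius `hexRadius`. -/
def neighbours (C : Set Plane) (c : Plane) : Set Plane :=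
  {c' ∈ C | c' ≠ c ∧ dist c c' < 2 * hexRadius}

theorem IsPacking.finite_neighbours {C : Set Plane} (hC : IsPacking C) (c : Plane) :
    (neighbours C c).Finite :=
  (hC.finite_inter_ball c (2 * hexRadius)).subset fun c' h =>
    ⟨h.1, by rw [mem_ball, dist_comm]; exact h.2.2⟩

/-- The Voronoi cell of `c`, truncated at the radius `hexRadius`. -/
def cell (C : Set Plane) (c : Plane) : Set Plane :=
  ball c hexRadius \ ⋃ c' ∈ neighbours C c, cap c c'

theorem IsPacking.measurableSet_cell {C : Set Plane} (hC : IsPacking C) (c : Plane) :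
    MeasurableSet (cell C c) :=
  measurableSet_ball.diff (hC.finite_neighbours c |>.measurableSet_biUnion
    fun c' _ => measurableSet_cap c c')

theorem cell_subset_ball (C : Set Plane) (c : Plane) : cell C c ⊆ ball c hexRadius :=
  sdiff_subset

/-- Two truncated discs with a common point belong to mutual neighbours, so the cap of the nearer
centre removes that point from the other cell. Caps contain the bisector, hence ties are harmless.
-/
theorem cell_disjoint {C : Set Plane} {c c' : Plane} (hc : c ∈ C) (hc' : c' ∈ C) (h : c ≠ c') :
    Disjoint (cell C c) (cell C c') := by
  rw [Set.disjoint_left]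
  rintro p ⟨hp1, hp2⟩ ⟨hp3, hp4⟩
  rw [mem_ball] at hp1 hp3
  have hd : dist c c' < 2 * hexRadius := by
    linarith [dist_triangle_left c c' p]
  rcases le_total (dist p c) (dist p c') with hle | hle
  · exact hp4 (mem_biUnion (show c ∈ neighbours C c' from ⟨hc, h, by rwa [dist_comm]⟩) ⟨hp3, hle⟩)
  · exact hp2 (mem_biUnion (show c' ∈ neighbours C c from ⟨hc', h.symm, hd⟩) ⟨hp1, hle⟩)

/-- A lower bound for the area of a cell, when the caps of distant neighbours occupy at most the
fraction `capRatio b` of their sectors. -/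
theorem IsPacking.le_volume_real_cell {C : Set Plane} (hC : IsPacking C) {c : Plane} (hc : c ∈ C)
    (t : Set Plane) {b : ℝ} (h0 : 0 < b) (hb : b ≤ Real.pi / 6)
    (hbt : ∀ c' ∈ neighbours C c, c' ∉ t → halfAngle (dist c c') ≤ b)
    (hκ : capRatio b ≤ capRatio (Real.pi / 6)) :
    Real.pi * (4 / 3) * (1 - capRatio b) - (capRatio (Real.pi / 6) - capRatio b) *
      (Real.pi * (2 / 9) * (neighbours C c ∩ t).ncard) ≤ volume.real (cell C c) := by
  classical
  have hr := hexRadius_pos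
  set N := (hC.finite_neighbours c).toFinset with hN
  have hNm : ∀ {c'}, c' ∈ N ↔ c' ∈ neighbours C c := by simp [hN]
  have hd2 : ∀ c' ∈ N, 2 ≤ dist c c' := fun c' h =>
    hC.two_le_dist hc (hNm.1 h).1 (hNm.1 h).2.1.symm
  have hd3 : ∀ c' ∈ N, dist c c' < 2 * hexRadius := fun c' h => (hNm.1 h).2.2
  have hball : volume.real (ball c hexRadius) = Real.pi * (4 / 3) := by
    rw [volume_real_ball c hr.le, hexRadius_sq]
  have hfin : volume (ball c hexRadius) ≠ ⊤ := measure_ball_lt_top.ne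
  have hsec : ∀ c', sector c c' ⊆ ball c hexRadius := fun c' p hp => hp.1
  have hcap : ∀ c', cap c c' ⊆ ball c hexRadius := fun c' p hp => hp.1
  -- the sectors are disjoint
  have h1 : ∑ c' ∈ N, volume.real (sector c c') ≤ Real.pi * (4 / 3) := by
    rw [← hball, ← measureReal_biUnion_finset (fun a ha b hb hab => sector_disjoint (hd2 a ha)
      (hd2 b hb) (hC.two_le_dist (hNm.1 ha).1 (hNm.1 hb).1 hab))
      (fun c' _ => measurableSet_sector c c')
      (fun c' _ => measure_ne_top_of_subset (hsec c') hfin)]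
    exact measureReal_mono (iUnion₂_subset fun c' _ => hsec c') hfin
  -- the area of the cell
  have h2 : Real.pi * (4 / 3) - ∑ c' ∈ N, volume.real (cap c c') ≤ volume.real (cell C c) := by
    have hU : (⋃ c' ∈ neighbours C c, cap c c') = ⋃ c' ∈ N, cap c c' := by
      simp only [hNm]
    have := le_measureReal_sdiff (μ := (volume : Measure Plane)) (s₁ := ball c hexRadius)
      (s₂ := ⋃ c' ∈ neighbours C c, cap c c')
      (measure_ne_top_of_subset (iUnion₂_subset fun c' _ => hcap c') hfin)
    have h3 := measureReal_biUnion_finset_le (μ := (volume : Measure Plane)) N (fun c' => cap c c')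
    rw [hU] at this
    rw [cell, hU, ← hball]
    linarith
  -- compare caps with sectors
  set κ := capRatio (Real.pi / 6)
  have hπ := Real.pi_pos
  have h3 : ∀ c' ∈ N, volume.real (cap c c') ≤ capRatio b * volume.real (sector c c') +
      (if c' ∈ t then (κ - capRatio b) * (Real.pi * (2 / 9)) else 0) := by
    intro c' h
    split_ifs with ht
    · have h4 := volume_real_cap_le_capRatio_mul (hd2 c' h) (hd3 c' h)
        (halfAngle_le_pi_div_six (hd2 c' h)) (by linarith)
      -- The largest possible sector has half-angle π/6 and area 4/3 · π/6 = 2π/9.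
      have h5 : volume.real (sector c c') ≤ Real.pi * (2 / 9) := by
        rw [volume_real_sector (hd2 c' h) (hd3 c' h)]
        linarith [halfAngle_le_pi_div_six (hd2 c' h)]
      have := mul_le_mul_of_nonneg_left h5 (sub_nonneg.2 hκ)
      linarith
    · have := volume_real_cap_le_capRatio_mul (hd2 c' h) (hd3 c' h)
        (hbt c' (hNm.1 h) ht) (by linarith)
      linarith
  have h4 := Finset.sum_le_sum h3
  rw [Finset.sum_add_distrib, ← Finset.mul_sum, ← Finset.sum_filter, Finset.sum_const,
    nsmul_eq_mul] at h4
  have h5 : ((N.filter (· ∈ t)).card : ℝ) = (neighbours C c ∩ t).ncard := by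
    rw [← ncard_coe_finset]
    congr 2
    ext x; simp [hNm]
  rw [h5] at h4
  have := mul_le_mul_of_nonneg_left h1 (capRatio_nonneg h0)
  linarith

/-- With b = π/6 every neighbour satisfies the bound on the half-angle, and the correction term
vanishes. -/
theorem IsPacking.sqrt_twelve_le_volume_cell {C : Set Plane} (hC : IsPacking C) {c : Plane}
    (hc : c ∈ C) : √12 ≤ volume.real (cell C c) := by
  have h := hC.le_volume_real_cell hc ∅ (b := Real.pi / 6) (by positivity) le_rfl
    (fun c' h _ => halfAngle_le_pi_div_six (hC.two_le_dist hc h.1 h.2.1.symm)) le_rfl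
  rwa [capRatio_pi_div_six, sub_self, zero_mul, sub_zero] at h

/-- If fewer than six centres are at distance less than `d` from `c`, then the cell of `c` is
larger than the regular hexagon by a definite amount. -/
theorem exists_add_le_volume_cell {d : ℝ} (hd : 2 < d) (hd' : d < 2 * hexRadius) :
    ∃ η > 0, ∀ C : Set Plane, IsPacking C → ∀ c ∈ C,
      {c' ∈ C | c' ≠ c ∧ dist c c' < d}.ncard < 6 → √12 + η ≤ volume.real (cell C c) := by
  have hb0 := halfAngle_pos hd'
  have hb := halfAngle_lt hd hd'
  have hπ := Real.pi_pos
  have hκ := capRatio_lt hb0 hb (by linarith)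
  set κ := capRatio (Real.pi / 6) with hκe
  set κ' := capRatio (halfAngle d)
  -- At most five near neighbours have sectors of total area at most 10π/9. Of the area 12π/9 of the
  -- disc this leaves at least 2π/9 on which the ratio κ improves to κ'.
  refine ⟨(κ - κ') * (Real.pi * (2 / 9)), by have := sub_pos.2 hκ; positivity, ?_⟩
  intro C hC c hc hcard
  have h := hC.le_volume_real_cell hc {c' | dist c c' < d} hb0 hb.le
    (fun c' _ h => halfAngle_le (not_lt.1 h)) hκ.le
  have hle : (neighbours C c ∩ {c' | dist c c' < d}).ncard ≤ 5 := by
    have : neighbours C c ∩ {c' | dist c c' < d} = {c' ∈ C | c' ≠ c ∧ dist c c' < d} := by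
      ext x
      simp only [neighbours, mem_inter_iff, mem_ofPred_eq]
      constructor
      · rintro ⟨⟨h1, h2, -⟩, h3⟩; exact ⟨h1, h2, h3⟩
      · rintro ⟨h1, h2, h3⟩; exact ⟨⟨h1, h2, h3.trans hd'⟩, h3⟩
    rw [this]; omega
  have hle' : ((neighbours C c ∩ {c' | dist c c' < d}).ncard : ℝ) ≤ 5 := by exact_mod_cast hle
  have h6 := capRatio_pi_div_six
  rw [← hκe] at h6 h
  have := mul_le_mul_of_nonneg_left hle' (mul_pos (sub_pos.2 hκ) hπ).le
  linarith

/-! ### Counting tiles in large discs -/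

theorem tendsto_add_sq_div_sq (k : ℝ) :
    Tendsto (fun R : ℝ => (R + k) ^ 2 / R ^ 2) atTop (𝓝 1) := by
  have h : Tendsto (fun R : ℝ => (1 + k / R) ^ 2) atTop (𝓝 ((1 + 0) ^ 2)) :=
    (tendsto_const_nhds.add (tendsto_const_nhds.div_atTop tendsto_id)).pow 2
  rw [add_zero, one_pow] at h
  refine h.congr' ?_
  filter_upwards [eventually_gt_atTop 0] with R hR
  field_simp

/-- Comparison of leading coefficients: a boundary layer of fixed width `k` is negligible as R
grows. -/
theorem le_of_mul_sq_le {a b k : ℝ} (h : ∀ R > 0, a * R ^ 2 ≤ b * (R + k) ^ 2) : a ≤ b := by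
  have h1 : Tendsto (fun R : ℝ => b * ((R + k) ^ 2 / R ^ 2)) atTop (𝓝 (b * 1)) :=
    (tendsto_add_sq_div_sq k).const_mul b
  rw [mul_one] at h1
  refine ge_of_tendsto h1 ?_
  filter_upwards [eventually_gt_atTop 0] with R hR
  rw [← mul_div_assoc, le_div_iff₀ (by positivity)]
  exact h R hR

theorem IsBuildingBlock.volume_real_pos {P : Set Plane} (hP : IsBuildingBlock P) :
    0 < volume.real P :=
  ENNReal.toReal_pos (Measure.measure_pos_of_nonempty_interior _ hP.nonempty_interior).ne'
    hP.isCompact.measure_lt_top.ne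

theorem IsBuildingBlock.measurableSet_image {P : Set Plane} (hP : IsBuildingBlock P)
    (g : Plane ≃ᵢ Plane) : MeasurableSet (g '' P) :=
  (hP.isCompact.image g.continuous).measurableSet

theorem IsBuildingBlock.volume_frontier_image {P : Set Plane} (hP : IsBuildingBlock P)
    (g : Plane ≃ᵢ Plane) : volume (frontier (g '' P)) = 0 := by
  have : frontier (g '' P) = g '' frontier P := (g.toHomeomorph.image_frontier P).symm
  rw [this, volume_image_isometryEquiv, hP.volume_frontier]

theorem IsBuildingBlock.image {P : Set Plane} (hP : IsBuildingBlock P) (g : Plane ≃ᵢ Plane) :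
    IsBuildingBlock (g '' P) where
  isCompact := hP.isCompact.image g.continuous
  nonempty_interior := by
    have : g '' interior P = interior (g '' P) := g.toHomeomorph.image_interior P
    rw [← this]; exact hP.nonempty_interior.image g
  volume_frontier := hP.volume_frontier_image g

theorem IsBuildingBlock.exists_diam {P : Set Plane} (hP : IsBuildingBlock P) :
    ∃ d : ℝ, 0 ≤ d ∧ ∀ p ∈ P, ∀ q ∈ P, dist p q ≤ d :=
  ⟨diam P, diam_nonneg, fun _ hp _ hq => dist_le_diam_of_mem hP.isCompact.isBounded hp hq⟩

/-- A point in two tiles but in neither frontier would be interior to both; frontiers of tiles are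
null. -/
theorem IsTiling.pairwise_aedisjoint {P : Set Plane} {G : Set (Plane ≃ᵢ Plane)}
    (hP : IsBuildingBlock P) (hG : IsTiling P G) :
    G.Pairwise (Function.onFun (AEDisjoint volume) fun g => g '' P) := by
  intro g hg g' hg' hne
  have h : g '' P ∩ g' '' P ⊆ frontier (g '' P) ∪ frontier (g' '' P) := by
    rintro p ⟨h1, h2⟩
    by_contra hc
    rw [mem_union, not_or, frontier, frontier] at hc
    have i1 : p ∈ interior (g '' P) := by
      by_contra hi; exact hc.1 ⟨subset_closure h1, hi⟩
    have i2 : p ∈ interior (g' '' P) := by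
      by_contra hi; exact hc.2 ⟨subset_closure h2, hi⟩
    exact (hG.disjoint hg hg' hne).le_bot ⟨i1, i2⟩
  exact measure_mono_null h (measure_union_null (hP.volume_frontier_image g)
    (hP.volume_frontier_image g'))

/-- The members of `G` that move `p` into the disc of radius `r` around `x`. -/
def tilesIn (G : Set (Plane ≃ᵢ Plane)) (p x : Plane) (r : ℝ) : Set (Plane ≃ᵢ Plane) :=
  {g ∈ G | g p ∈ ball x r}

section Counting

variable {P : Set Plane} {G : Set (Plane ≃ᵢ Plane)} {p : Plane} {d : ℝ}

theorem image_subset_ball_of_mem_tilesIn (hd : ∀ q ∈ P, dist q p ≤ d) {x : Plane} {r : ℝ}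
    {g : Plane ≃ᵢ Plane} (hg : g ∈ tilesIn G p x r) : g '' P ⊆ ball x (r + d) := by
  rintro _ ⟨q, hq, rfl⟩
  have h1 : dist (g q) (g p) ≤ d := by rw [g.dist_eq]; exact hd q hq
  have h2 : dist (g p) x < r := hg.2
  rw [mem_ball]
  linarith [dist_triangle (g q) (g p) x]

theorem IsTiling.ball_subset_biUnion (hG : IsTiling P G) (hd : ∀ q ∈ P, dist q p ≤ d) (x : Plane)
    (r : ℝ) : ball x r ⊆ ⋃ g ∈ tilesIn G p x (r + d), g '' P := by
  intro y hy
  have : y ∈ ⋃ g ∈ G, g '' P := hG.covers ▸ mem_univ y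
  rw [mem_iUnion₂] at this
  obtain ⟨g, hg, q, hq, rfl⟩ := this
  refine mem_biUnion (⟨hg, ?_⟩ : g ∈ tilesIn G p x (r + d)) (mem_image_of_mem g hq)
  have h1 : dist (g q) (g p) ≤ d := by rw [g.dist_eq]; exact hd q hq
  rw [mem_ball] at hy ⊢
  linarith [dist_triangle_left (g p) x (g q)]

/-- The packing half of the count: tiles based in B(x, r) lie in B(x, r + d) and overlap in null
sets. -/
theorem IsTiling.finite_tilesIn_and (hP : IsBuildingBlock P) (hG : IsTiling P G) (hd0 : 0 ≤ d)
    (hd : ∀ q ∈ P, dist q p ≤ d) (x : Plane) {r : ℝ} (hr : 0 ≤ r) : (tilesIn G p x r).Finite ∧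
      volume.real P * (tilesIn G p x r).ncard ≤ Real.pi * (r + d) ^ 2 := by
  rw [← volume_real_ball x (add_nonneg hr hd0)]
  exact finite_and_mul_ncard_le (A := fun g : Plane ≃ᵢ Plane => g '' P) hP.volume_real_pos
    (fun g _ => (hP.measurableSet_image g).nullMeasurableSet)
    ((hG.pairwise_aedisjoint hP).mono fun g hg => hg.1)
    (fun g _ => (volume_real_image_isometryEquiv g P).ge) measure_ball_lt_top.ne
    (fun g hg => image_subset_ball_of_mem_tilesIn hd hg)

/-- The covering half of the count: the tiles based in B(x, r + d) cover B(x, r). -/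
theorem IsTiling.le_mul_ncard_tilesIn (hP : IsBuildingBlock P) (hG : IsTiling P G) (hd0 : 0 ≤ d)
    (hd : ∀ q ∈ P, dist q p ≤ d) (x : Plane) {r : ℝ} (hr : 0 ≤ r) :
      Real.pi * r ^ 2 ≤ volume.real P * (tilesIn G p x (r + d)).ncard := by
  have hfin := (hG.finite_tilesIn_and hP hd0 hd x (add_nonneg hr hd0)).1
  have h1 := hG.ball_subset_biUnion hd x r
  have h2 : (⋃ g ∈ tilesIn G p x (r + d), g '' P) = ⋃ g ∈ hfin.toFinset, g '' P := by simp
  rw [h2] at h1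
  have h3 := measureReal_mono (μ := volume) h1 (measure_ne_top_of_subset
    (iUnion₂_subset fun g hg => image_subset_ball_of_mem_tilesIn hd (by simpa using hg))
    (measure_ball_lt_top (x := x) (r := r + d + d)).ne)
  have h4 := measureReal_biUnion_finset_le (μ := (volume : Measure Plane)) hfin.toFinset
    (fun g => g '' P)
  simp only [volume_real_image_isometryEquiv, Finset.sum_const, nsmul_eq_mul] at h4
  rw [volume_real_ball x hr] at h3
  rw [ncard_eq_toFinset_card _ hfin]
  linarith

end Counting

theorem IsPacking.countable {C : Set Plane} (hC : IsPacking C) : C.Countable := by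
  have : C = ⋃ n : ℕ, C ∩ ball 0 n := by
    rw [← inter_iUnion, iUnion_ball_nat, inter_univ]
  rw [this]
  exact countable_iUnion fun n => (hC.finite_inter_ball 0 n).countable

theorem IsPacking.measurableSet_covered {C : Set Plane} (hC : IsPacking C) :
    MeasurableSet (covered C) :=
  MeasurableSet.biUnion hC.countable fun _ _ => measurableSet_closedBall

/-- A packing with a universal local density has the same global density. -/
theorem hasGlobalDensity_of_isUniversalLocalDensity {C P : Set Plane} {δ : ℝ} (hC : IsPacking C)
    (h : IsUniversalLocalDensity C P δ) : HasGlobalDensity C δ := by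
  obtain ⟨hP, G, hG, hδ⟩ := h
  obtain ⟨d, hd0, hd⟩ := hP.exists_diam
  obtain ⟨p, hp⟩ := hP.nonempty_interior.mono interior_subset
  replace hd : ∀ q ∈ P, dist q p ≤ d := fun q hq => hd q hq p hp
  have hv := hP.volume_real_pos
  have hcov : ∀ g ∈ G, volume.real (covered C ∩ g '' P) = δ * volume.real P := by
    intro g hg
    have := hδ g hg
    rw [localDensity, volume_real_image_isometryEquiv, div_eq_iff hv.ne'] at this
    exact this
  -- Nonnegativity allows the tile counts to be multiplied by δ; it comes from any one tile, which
  -- exists because the tiles cover the plane.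
  have hδ0 : 0 ≤ δ := by
    obtain ⟨g, hg, -⟩ := mem_iUnion₂.1 (hG.covers ▸ mem_univ p : p ∈ ⋃ g ∈ G, g '' P)
    rw [← hδ g hg]
    exact div_nonneg measureReal_nonneg measureReal_nonneg
  have hπ := Real.pi_pos
  -- The tiles based in B(x, R + d) cover B(x, R) and are contained in B(x, R + 2d).
  have upper : ∀ x : Plane, ∀ R > 0,
      volume.real (covered C ∩ ball x R) ≤ δ * (Real.pi * (R + (d + d)) ^ 2) := by
    intro x R hR
    obtain ⟨hfin, hle⟩ := hG.finite_tilesIn_and hP hd0 hd x (add_nonneg hR.le hd0)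
    have h1 : covered C ∩ ball x R ⊆ ⋃ g ∈ hfin.toFinset, covered C ∩ g '' P := by
      rintro y ⟨hy1, hy2⟩
      obtain ⟨g, hg, hyg⟩ := mem_iUnion₂.1 (hG.ball_subset_biUnion hd x R hy2)
      exact mem_biUnion (by simpa using hg) ⟨hy1, hyg⟩
    have h2 := measureReal_mono (μ := volume) h1 (measure_ne_top_of_subset
      (iUnion₂_subset fun g hg => inter_subset_right.trans
        (image_subset_ball_of_mem_tilesIn hd (by simpa using hg)))
      (measure_ball_lt_top (x := x) (r := R + d + d)).ne)
    have h3 := measureReal_biUnion_finset_le (μ := (volume : Measure Plane)) hfin.toFinset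
      (fun g => covered C ∩ g '' P)
    rw [Finset.sum_congr rfl (fun g hg => hcov g ((hfin.mem_toFinset.1 hg).1)),
      Finset.sum_const, nsmul_eq_mul, ← ncard_eq_toFinset_card _ hfin] at h3
    rw [← add_assoc]
    have := mul_le_mul_of_nonneg_left hle hδ0
    linarith
  -- The tiles based in B(x, R - d) lie in B(x, R) and cover B(x, R - 2d).
  have lower : ∀ x : Plane, ∀ R > d + d,
      δ * (Real.pi * (R + (-(d + d))) ^ 2) ≤ volume.real (covered C ∩ ball x R) := by
    intro x R hR
    obtain ⟨hfin, -⟩ := hG.finite_tilesIn_and hP hd0 hd x (r := R - d) (by linarith)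
    have hle := hG.le_mul_ncard_tilesIn hP hd0 hd x (r := R - (d + d)) (by linarith)
    rw [show R - (d + d) + d = R - d by ring] at hle
    have hsub : ∀ g ∈ hfin.toFinset, covered C ∩ g '' P ⊆ covered C ∩ ball x R := by
      intro g hg
      have := image_subset_ball_of_mem_tilesIn hd (hfin.mem_toFinset.1 hg)
      rw [sub_add_cancel] at this
      exact inter_subset_inter_right _ this
    have hfinite : volume (covered C ∩ ball x R) ≠ ⊤ :=
      measure_ne_top_of_subset inter_subset_right measure_ball_lt_top.ne
    have h2 := measureReal_mono (μ := volume) (iUnion₂_subset hsub) hfinite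
    rw [measureReal_biUnion_finset₀
      (fun g hg g' hg' hne => ((hG.pairwise_aedisjoint hP) (hfin.mem_toFinset.1 hg).1
        (hfin.mem_toFinset.1 hg').1 hne).mono inter_subset_right inter_subset_right)
      (fun g _ => (hC.measurableSet_covered.inter (hP.measurableSet_image g)).nullMeasurableSet)
      (fun g hg => measure_ne_top_of_subset (hsub g hg) hfinite),
      Finset.sum_congr rfl (fun g hg => hcov g ((hfin.mem_toFinset.1 hg).1)),
      Finset.sum_const, nsmul_eq_mul, ← ncard_eq_toFinset_card _ hfin] at h2
    rw [← sub_eq_add_neg]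
    have := mul_le_mul_of_nonneg_left hle hδ0
    linarith
  intro x
  have t1 := (tendsto_add_sq_div_sq (-(d + d))).const_mul δ
  have t2 := (tendsto_add_sq_div_sq (d + d)).const_mul δ
  rw [mul_one] at t1 t2
  refine tendsto_of_tendsto_of_tendsto_of_le_of_le' t1 t2 ?_ ?_
  · filter_upwards [eventually_gt_atTop (d + d)] with R hR
    have hR0 : 0 < R := by linarith
    rw [localDensity, volume_real_ball x hR0.le, le_div_iff₀ (by positivity)]
    refine le_trans (le_of_eq ?_) (lower x R hR)
    field_simp
  · filter_upwards [eventually_gt_atTop 0] with R hR0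
    rw [localDensity, volume_real_ball x hR0.le, div_le_iff₀ (by positivity)]
    refine (upper x R hR0).trans (le_of_eq ?_)
    field_simp

/-! ### The upper bound for the density of a packing -/

theorem IsPacking.mul_ncard_inter_ball_le {C : Set Plane} (hC : IsPacking C) {v : ℝ} (hv : 0 < v)
    (h : ∀ c ∈ C, v ≤ volume.real (cell C c)) (x : Plane) {r : ℝ} (hr : 0 ≤ r) :
    v * (C ∩ ball x r).ncard ≤ Real.pi * (r + 2) ^ 2 := by
  rw [← volume_real_ball x (by linarith : 0 ≤ r + 2)]
  refine (finite_and_mul_ncard_le hv (fun c _ => (hC.measurableSet_cell c).nullMeasurableSet)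
    (fun c hc c' hc' hne => (cell_disjoint hc.1 hc'.1 hne).aedisjoint) (fun c hc => h c hc.1)
    measure_ball_lt_top.ne ?_).2
  rintro c ⟨-, hc⟩
  refine (cell_subset_ball C c).trans (ball_subset_ball' ?_)
  rw [mem_ball] at hc
  linarith [hexRadius_lt]

/-- Only discs with centres in B(x, R + 1) meet B(x, R); their cells lie within a further distance
2, which gives R + 3. -/
theorem IsPacking.volume_real_covered_inter_ball_le {C : Set Plane} (hC : IsPacking C) (x : Plane)
    {R : ℝ} (hR : 0 ≤ R) :
    √12 * volume.real (covered C ∩ ball x R) ≤ Real.pi * (Real.pi * (R + 3) ^ 2) := by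
  have hfin := hC.finite_inter_ball x (R + 1)
  have h1 := hC.mul_ncard_inter_ball_le (by positivity)
    (fun c hc => hC.sqrt_twelve_le_volume_cell hc) x (add_nonneg hR zero_le_one)
  have h2 : covered C ∩ ball x R ⊆ ⋃ c ∈ hfin.toFinset, closedBall c 1 := by
    rintro y ⟨hy1, hy2⟩
    obtain ⟨c, hc, hyc⟩ := mem_iUnion₂.1 hy1
    refine mem_biUnion ?_ hyc
    rw [Finset.mem_coe, hfin.mem_toFinset]
    refine ⟨hc, ?_⟩
    rw [mem_ball] at *
    rw [mem_closedBall] at hyc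
    linarith [dist_triangle_left c x y]
  have hball : ∀ c : Plane, volume.real (closedBall c 1) = Real.pi := by
    intro c
    rw [measureReal_def, Measure.addHaar_closedBall_eq_addHaar_ball, ← measureReal_def,
      volume_real_ball c zero_le_one, one_pow, mul_one]
  have h3 := measureReal_mono (μ := volume) h2 ((measure_biUnion_lt_top (Finset.finite_toSet _)
    fun c _ => measure_closedBall_lt_top).ne)
  have h4 := measureReal_biUnion_finset_le (μ := (volume : Measure Plane)) hfin.toFinset
    (fun c => closedBall c 1)
  simp only [hball, Finset.sum_const, nsmul_eq_mul] at h4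
  rw [← ncard_eq_toFinset_card _ hfin] at h4
  rw [show R + 1 + 2 = R + 3 by ring] at h1
  have h5 := mul_le_mul_of_nonneg_left (h3.trans h4) (Real.sqrt_nonneg 12)
  have h6 := mul_le_mul_of_nonneg_left h1 Real.pi_pos.le
  linarith

theorem localDensity_nonneg (C Q : Set Plane) : 0 ≤ localDensity C Q :=
  div_nonneg measureReal_nonneg measureReal_nonneg

theorem IsPacking.upperDensity_le {C : Set Plane} (hC : IsPacking C) (x : Plane) :
    upperDensity C x ≤ Real.pi / √12 := by
  have ht := (tendsto_add_sq_div_sq 3).const_mul (Real.pi / √12)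
  rw [mul_one] at ht
  rw [upperDensity, ← ht.limsup_eq]
  refine limsup_le_limsup ?_ ?_ ht.isBoundedUnder_le
  · filter_upwards [eventually_gt_atTop 0] with R hR
    have := hC.volume_real_covered_inter_ball_le x hR.le
    have h12 : 0 < √12 := by positivity
    have hπ := Real.pi_pos
    rw [localDensity, volume_real_ball x hR.le, div_le_iff₀ (by positivity)]
    rw [← mul_le_mul_iff_right₀ h12]
    refine this.trans (le_of_eq ?_)
    field_simp
  -- The real `limsup` is meaningful only for suitably bounded functions; the lower bound 0 supplies
  -- the coboundedness that the comparison requires.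
  · exact (isBoundedUnder_of ⟨0, fun R => localDensity_nonneg C _⟩ :
      IsBoundedUnder (· ≥ ·) atTop fun R : ℝ => localDensity C (ball x R)).isCoboundedUnder_le

theorem HasGlobalDensity.le {C : Set Plane} {δ : ℝ} (hC : IsPacking C)
    (h : HasGlobalDensity C δ) : δ ≤ Real.pi / √12 :=
  (h 0).limsup_eq ▸ hC.upperDensity_le 0

/-! ### The packing formed by the centres of the tiles -/

section Centres

variable {P : Set Plane} {G : Set (Plane ≃ᵢ Plane)} {c : Plane}

theorem ball_subset_interior_image (hc : closedBall c 1 ⊆ P) (g : Plane ≃ᵢ Plane) :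
    ball (g c) 1 ⊆ interior (g '' P) := by
  refine interior_maximal ?_ isOpen_ball
  rw [← g.image_ball]
  exact image_mono (ball_subset_closedBall.trans hc)

theorem IsTiling.two_le_dist (hG : IsTiling P G) (hc : closedBall c 1 ⊆ P) {g g' : Plane ≃ᵢ Plane}
    (hg : g ∈ G) (hg' : g' ∈ G) (h : g ≠ g') : 2 ≤ dist (g c) (g' c) := by
  have := (disjoint_ball_ball_iff one_pos one_pos).1 ((hG.disjoint hg hg' h).mono
    (ball_subset_interior_image hc g) (ball_subset_interior_image hc g'))
  linarith

/-- Lets tiles be counted by their centres: distinct members of `G` have centres at distance at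
least 2. -/
theorem IsTiling.injOn (hG : IsTiling P G) (hc : closedBall c 1 ⊆ P) :
    InjOn (fun g : Plane ≃ᵢ Plane => g c) G := by
  intro g hg g' hg' h
  by_contra hne
  have := hG.two_le_dist hc hg hg' hne
  simp only at h
  rw [h, dist_self] at this
  linarith

theorem IsTiling.isPacking (hG : IsTiling P G) (hc : closedBall c 1 ⊆ P) :
    IsPacking ((fun g : Plane ≃ᵢ Plane => g c) '' G) := by
  apply isPacking_of_two_le_dist
  rintro _ ⟨g, hg, rfl⟩ _ ⟨g', hg', rfl⟩ h
  exact hG.two_le_dist hc hg hg' (fun e => h (e ▸ rfl))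

/-- A lower bound for the areas of all cells is a lower bound for the area of the tile. -/
theorem IsTiling.le_volume_real (hP : IsBuildingBlock P) (hG : IsTiling P G)
    (hc : closedBall c 1 ⊆ P) {v : ℝ} (hv : 0 < v)
    (h : ∀ g ∈ G, v ≤ volume.real (cell ((fun g : Plane ≃ᵢ Plane => g c) '' G) (g c))) :
    v ≤ volume.real P := by
  obtain ⟨d, hd0, hd⟩ := hP.exists_diam
  have hcP : c ∈ P := hc (mem_closedBall_self zero_le_one)
  replace hd : ∀ q ∈ P, dist q c ≤ d := fun q hq => hd q hq c hcP
  have hπ := Real.pi_pos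
  -- The width `d` is lost in covering by tiles, the width 2 in packing the cells.
  refine le_of_mul_sq_le (k := d + 2) fun R hR => ?_
  have h1 := hG.le_mul_ncard_tilesIn hP hd0 hd 0 hR.le
  have h2 := (hG.isPacking hc).mul_ncard_inter_ball_le hv (by
    rintro _ ⟨g, hg, rfl⟩; exact h g hg) 0 (add_nonneg hR.le hd0)
  have h3 : ((fun g : Plane ≃ᵢ Plane => g c) '' G ∩ ball 0 (R + d)).ncard =
      (tilesIn G c 0 (R + d)).ncard := by
    rw [← InjOn.ncard_image ((hG.injOn hc).mono (fun g hg => hg.1 : tilesIn G c 0 (R + d) ⊆ G))]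
    congr 1
    ext x
    constructor
    · rintro ⟨⟨g, hg, rfl⟩, hx⟩; exact ⟨g, ⟨hg, hx⟩, rfl⟩
    · rintro ⟨g, ⟨hg, hx⟩, rfl⟩; exact ⟨⟨g, hg, rfl⟩, hx⟩
  rw [h3] at h2
  have h4 := mul_le_mul_of_nonneg_left h1 hv.le
  have h5 := mul_le_mul_of_nonneg_left h2 hP.volume_real_pos.le
  have h6 : Real.pi * (v * R ^ 2) ≤ Real.pi * (volume.real P * (R + (d + 2)) ^ 2) := by
    rw [← add_assoc]
    linarith
  exact le_of_mul_le_mul_left h6 hπ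

end Centres

theorem IsUnitDiscTile.sqrt_twelve_le {P : Set Plane} (hP : IsUnitDiscTile P) :
    √12 ≤ volume.real P := by
  obtain ⟨c, hc⟩ := hP.contains_disc
  obtain ⟨G, hG⟩ := hP.tiles
  exact hG.le_volume_real hP.block hc (by positivity) fun g hg =>
    (hG.isPacking hc).sqrt_twelve_le_volume_cell (mem_image_of_mem _ hg)

/-- In a tiling by a block of the least possible area there are tiles with six neighbours almost
touching. -/
theorem IsTiling.exists_six_near {P : Set Plane} {G : Set (Plane ≃ᵢ Plane)} {c : Plane}
    (hP : IsBuildingBlock P) (hG : IsTiling P G) (hc : closedBall c 1 ⊆ P)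
    (hv : volume.real P ≤ √12) {d : ℝ} (hd : 2 < d) (hd' : d < 2 * hexRadius) :
    ∃ g ∈ G, 6 ≤ {c' ∈ (fun g : Plane ≃ᵢ Plane => g c) '' G |
      c' ≠ g c ∧ dist (g c) c' < d}.ncard := by
  by_contra! hcon
  obtain ⟨η, hη, h⟩ := exists_add_le_volume_cell hd hd'
  have := hG.le_volume_real hP hc (v := √12 + η) (by positivity) fun g hg =>
    h _ (hG.isPacking hc) _ (mem_image_of_mem _ hg) (hcon g hg)
  linarith

/-! ### Lattice coordinates and the hexagonal packing -/

/-- The point with coordinates `s`, `t` in the basis of the hexagonal lattice. -/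
def latticePoint (s t : ℝ) : Plane := s • !₂[(2 : ℝ), 0] + t • !₂[(1 : ℝ), √3]

/-- The first coordinate in the basis of the hexagonal lattice. -/
def fstCoord (p : Plane) : ℝ := (p 0 - p 1 / √3) / 2

/-- The second coordinate in the basis of the hexagonal lattice. -/
def sndCoord (p : Plane) : ℝ := p 1 / √3

theorem latticePoint_apply_zero (s t : ℝ) : latticePoint s t 0 = 2 * s + t := by
  simp [latticePoint]; ring

theorem latticePoint_apply_one (s t : ℝ) : latticePoint s t 1 = √3 * t := by
  simp [latticePoint]; ring

@[simp] theorem sndCoord_latticePoint (s t : ℝ) : sndCoord (latticePoint s t) = t := by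
  rw [sndCoord, latticePoint_apply_one]; field_simp

@[simp] theorem fstCoord_latticePoint (s t : ℝ) : fstCoord (latticePoint s t) = s := by
  rw [fstCoord, latticePoint_apply_one, latticePoint_apply_zero]; field_simp; ring

theorem plane_ext {p q : Plane} (h0 : p 0 = q 0) (h1 : p 1 = q 1) : p = q := by
  ext i; fin_cases i
  · exact h0
  · exact h1

@[simp] theorem latticePoint_coords (p : Plane) : latticePoint (fstCoord p) (sndCoord p) = p := by
  apply plane_ext
  · rw [latticePoint_apply_zero, fstCoord, sndCoord]; ring
  · rw [latticePoint_apply_one, sndCoord]; field_simp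

@[simp] theorem fstCoord_add (p q : Plane) : fstCoord (p + q) = fstCoord p + fstCoord q := by
  simp only [fstCoord, PiLp.add_apply]; ring

@[simp] theorem sndCoord_add (p q : Plane) : sndCoord (p + q) = sndCoord p + sndCoord q := by
  simp only [sndCoord, PiLp.add_apply]; ring

@[simp] theorem fstCoord_sub (p q : Plane) : fstCoord (p - q) = fstCoord p - fstCoord q := by
  simp only [fstCoord, PiLp.sub_apply]; ring

@[simp] theorem sndCoord_sub (p q : Plane) : sndCoord (p - q) = sndCoord p - sndCoord q := by
  simp only [sndCoord, PiLp.sub_apply]; ring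

@[simp] theorem fstCoord_smul (a : ℝ) (p : Plane) : fstCoord (a • p) = a * fstCoord p := by
  simp only [fstCoord, PiLp.smul_apply, smul_eq_mul]; ring

@[simp] theorem sndCoord_smul (a : ℝ) (p : Plane) : sndCoord (a • p) = a * sndCoord p := by
  simp only [sndCoord, PiLp.smul_apply, smul_eq_mul]; ring

theorem coords_ext {p q : Plane} (h0 : fstCoord p = fstCoord q) (h1 : sndCoord p = sndCoord q) :
    p = q := by
  rw [← latticePoint_coords p, h0, h1, latticePoint_coords]

@[fun_prop] theorem continuous_fstCoord : Continuous fstCoord := by unfold fstCoord; fun_prop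

@[fun_prop] theorem continuous_sndCoord : Continuous sndCoord := by unfold sndCoord; fun_prop

/-- The basis vectors have squared length 4 and inner product 2. -/
theorem norm_sq_eq_coords (p : Plane) :
    ‖p‖ ^ 2 = 4 * (fstCoord p ^ 2 + fstCoord p * sndCoord p + sndCoord p ^ 2) := by
  conv_lhs => rw [← latticePoint_coords p]
  rw [EuclideanSpace.norm_eq, Fin.sum_univ_two, Real.sq_sqrt (by positivity),
    latticePoint_apply_zero, latticePoint_apply_one, Real.norm_eq_abs, Real.norm_eq_abs, sq_abs,
    sq_abs, mul_pow, Real.sq_sqrt (by norm_num)]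
  ring

theorem mem_hexagonalPacking {p : Plane} :
    p ∈ hexagonalPacking ↔ ∃ m n : ℤ, fstCoord p = m ∧ sndCoord p = n := by
  constructor
  · rintro ⟨m, n, rfl⟩
    exact ⟨m, n, fstCoord_latticePoint m n, sndCoord_latticePoint m n⟩
  · rintro ⟨m, n, h1, h2⟩
    refine ⟨m, n, ?_⟩
    rw [← h1, ← h2]
    exact (latticePoint_coords p).symm

theorem latticePoint_mem_hexagonalPacking (m n : ℤ) : latticePoint m n ∈ hexagonalPacking :=
  ⟨m, n, rfl⟩

theorem add_mem_hexagonalPacking {p q : Plane} (hp : p ∈ hexagonalPacking)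
    (hq : q ∈ hexagonalPacking) : p + q ∈ hexagonalPacking := by
  rw [mem_hexagonalPacking] at *
  obtain ⟨m, n, h1, h2⟩ := hp
  obtain ⟨m', n', h3, h4⟩ := hq
  exact ⟨m + m', n + n', by simp [h1, h3], by simp [h2, h4]⟩

theorem sub_mem_hexagonalPacking {p q : Plane} (hp : p ∈ hexagonalPacking)
    (hq : q ∈ hexagonalPacking) : p - q ∈ hexagonalPacking := by
  rw [mem_hexagonalPacking] at *
  obtain ⟨m, n, h1, h2⟩ := hp
  obtain ⟨m', n', h3, h4⟩ := hq
  exact ⟨m - m', n - n', by simp [h1, h3], by simp [h2, h4]⟩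

/-- The form m² + mn + n² is positive definite with integer values, hence at least 1 at a nonzero
lattice vector. -/
theorem isPacking_hexagonalPacking : IsPacking hexagonalPacking := by
  apply isPacking_of_two_le_dist
  intro c hc c' hc' hne
  obtain ⟨m, n, h1, h2⟩ := mem_hexagonalPacking.1 (sub_mem_hexagonalPacking hc hc')
  have h := norm_sq_eq_coords (c - c')
  rw [h1, h2] at h
  have hmn : 1 ≤ m ^ 2 + m * n + n ^ 2 := by
    by_contra hcon
    have h0 : m ^ 2 + m * n + n ^ 2 = 0 := by nlinarith [sq_nonneg (m + n), sq_nonneg m, sq_nonneg n]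
    have hm : m = 0 := by nlinarith [sq_nonneg (m + 2 * n)]
    have hn : n = 0 := by nlinarith [sq_nonneg (2 * m + n)]
    subst hm hn
    apply hne
    rw [← sub_eq_zero]
    apply coords_ext
    · rw [h1]; simp [fstCoord]
    · rw [h2]; simp [sndCoord]
  have hmn' : (1 : ℝ) ≤ (m : ℝ) ^ 2 + m * n + n ^ 2 := by exact_mod_cast hmn
  rw [dist_eq_norm]
  nlinarith [norm_nonneg (c - c')]

/-- A small step ε in the coordinate direction (a, b) raises the linear form by ε(a² + b²) > 0, so
it cannot attain its bound in the interior. -/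
theorem lt_of_mem_interior {S : Set Plane} {a b k : ℝ} (hab : a ≠ 0 ∨ b ≠ 0)
    (h : ∀ p ∈ S, a * fstCoord p + b * sndCoord p ≤ k) {p : Plane} (hp : p ∈ interior S) :
    a * fstCoord p + b * sndCoord p < k := by
  have hlim : Tendsto (fun ε : ℝ => p + ε • latticePoint a b) (𝓝[>] 0) (𝓝 p) := by
    have : Continuous fun ε : ℝ => p + ε • latticePoint a b := by fun_prop
    have h0 := this.tendsto 0
    simp only [zero_smul, add_zero] at h0
    exact h0.mono_left nhdsWithin_le_nhds
  have hmem := hlim.eventually (mem_interior_iff_mem_nhds.1 hp)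
  obtain ⟨ε, hε, hε0⟩ := (hmem.and self_mem_nhdsWithin).exists
  have := h _ hε
  simp only [fstCoord_add, fstCoord_smul, fstCoord_latticePoint, sndCoord_add, sndCoord_smul,
    sndCoord_latticePoint] at this
  have hpos : 0 < a ^ 2 + b ^ 2 := by
    rcases hab with h | h <;> positivity
  have : 0 < ε * (a ^ 2 + b ^ 2) := mul_pos hε0 hpos
  linarith

theorem latticePoint_mem_of_convex {S : Set Plane} (hS : Convex ℝ S) {a b c d x y : ℝ}
    (h1 : latticePoint a b ∈ S) (h2 : latticePoint c d ∈ S) (hx : 0 ≤ x) (hy : 0 ≤ y)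
    (hxy : x + y = 1) : latticePoint (x * a + y * c) (x * b + y * d) ∈ S := by
  have := hS h1 h2 hx hy hxy
  convert this using 1
  apply coords_ext <;> simp

theorem convex_setOf_coords_le (a b k : ℝ) :
    Convex ℝ {p : Plane | a * fstCoord p + b * sndCoord p ≤ k} := by
  intro p hp q hq x y hx hy hxy
  simp only [mem_ofPred_eq, fstCoord_add, fstCoord_smul, sndCoord_add, sndCoord_smul] at *
  have h1 := mul_le_mul_of_nonneg_left hp hx
  have h2 := mul_le_mul_of_nonneg_left hq hy
  have h3 : x * k + y * k = k := by rw [← add_mul, hxy, one_mul]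
  linarith

/-! ### The regular hexagon: half-planes, area and lattice tiling -/

/-- The three forms are half the inner products with the shortest lattice vectors, so the conditions
describe the Voronoi cell of 0. Conversely, a point satisfying them lies on a vertical chord whose
endpoints are on the upper and lower edges. -/
theorem mem_regularHexagon {p : Plane} : p ∈ regularHexagon ↔
    |2 * fstCoord p + sndCoord p| ≤ 1 ∧ |fstCoord p + 2 * sndCoord p| ≤ 1 ∧
      |fstCoord p - sndCoord p| ≤ 1 := by
  have hv : ∀ x y s t : ℝ, x = 2 * s + t → y = t * 3 / √3 → !₂[x, y] = latticePoint s t := by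
    intro x y s t hx hy
    apply plane_ext
    · rw [latticePoint_apply_zero, ← hx]; rfl
    · rw [latticePoint_apply_one]
      change y = _
      rw [hy]; field_simp; rw [Real.sq_sqrt (by norm_num)]
  have hH : regularHexagon = convexHull ℝ {latticePoint (1 / 3) (1 / 3),
      latticePoint (-1 / 3) (2 / 3), latticePoint (-2 / 3) (1 / 3),
      latticePoint (-1 / 3) (-1 / 3), latticePoint (1 / 3) (-2 / 3),
      latticePoint (2 / 3) (-1 / 3)} := by
    rw [regularHexagon, hv 1 (1 / √3) (1 / 3) (1 / 3) (by ring) (by ring),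
      hv 0 (2 / √3) (-1 / 3) (2 / 3) (by ring) (by ring),
      hv (-1) (1 / √3) (-2 / 3) (1 / 3) (by ring) (by ring),
      hv (-1) (-(1 / √3)) (-1 / 3) (-1 / 3) (by ring) (by ring),
      hv 0 (-(2 / √3)) (1 / 3) (-2 / 3) (by ring) (by ring),
      hv 1 (-(1 / √3)) (2 / 3) (-1 / 3) (by ring) (by ring)]
  constructor
  · intro hp
    have hsub : regularHexagon ⊆ (({p | 2 * fstCoord p + 1 * sndCoord p ≤ 1} ∩
        {p | (-2) * fstCoord p + (-1) * sndCoord p ≤ 1}) ∩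
        ({p | 1 * fstCoord p + 2 * sndCoord p ≤ 1} ∩
        {p | (-1) * fstCoord p + (-2) * sndCoord p ≤ 1})) ∩
        ({p | 1 * fstCoord p + (-1) * sndCoord p ≤ 1} ∩
        {p | (-1) * fstCoord p + 1 * sndCoord p ≤ 1}) := by
      rw [hH]
      apply convexHull_min
      · rintro q (rfl | rfl | rfl | rfl | rfl | rfl) <;>
          simp only [mem_inter_iff, mem_ofPred_eq, fstCoord_latticePoint,
            sndCoord_latticePoint] <;> norm_num
      · exact (((convex_setOf_coords_le _ _ _).inter (convex_setOf_coords_le _ _ _)).inter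
          ((convex_setOf_coords_le _ _ _).inter (convex_setOf_coords_le _ _ _))).inter
          ((convex_setOf_coords_le _ _ _).inter (convex_setOf_coords_le _ _ _))
    obtain ⟨⟨⟨h1, h2⟩, h3, h4⟩, h5, h6⟩ := hsub hp
    simp only [mem_ofPred_eq] at *
    refine ⟨abs_le.2 ⟨?_, ?_⟩, abs_le.2 ⟨?_, ?_⟩, abs_le.2 ⟨?_, ?_⟩⟩ <;> linarith
  · rintro ⟨h1, h2, h3⟩
    rw [← latticePoint_coords p]
    generalize fstCoord p = s at *
    generalize sndCoord p = t at *
    have hc : Convex ℝ regularHexagon := convex_convexHull ℝ _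
    have hm : ∀ q, q ∈ ({latticePoint (1 / 3) (1 / 3),
      latticePoint (-1 / 3) (2 / 3), latticePoint (-2 / 3) (1 / 3),
      latticePoint (-1 / 3) (-1 / 3), latticePoint (1 / 3) (-2 / 3),
      latticePoint (2 / 3) (-1 / 3)} : Set Plane) → q ∈ regularHexagon := by
      intro q hq; rw [hH]; exact subset_convexHull ℝ _ hq
    have v1 := hm (latticePoint (1 / 3) (1 / 3)) (by simp)
    have v2 := hm (latticePoint (-1 / 3) (2 / 3)) (by simp)
    have v3 := hm (latticePoint (-2 / 3) (1 / 3)) (by simp)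
    have v4 := hm (latticePoint (-1 / 3) (-1 / 3)) (by simp)
    have v5 := hm (latticePoint (1 / 3) (-2 / 3)) (by simp)
    have v6 := hm (latticePoint (2 / 3) (-1 / 3)) (by simp)
    rw [abs_le] at h1 h2 h3
    -- a point on the vertical chord between two boundary points
    have chord : ∀ T : ℝ, 0 < T → -T ≤ t → t ≤ T →
        latticePoint ((2 * s + t - T) / 2) T ∈ regularHexagon →
        latticePoint ((2 * s + t + T) / 2) (-T) ∈ regularHexagon →
        latticePoint s t ∈ regularHexagon := by
      intro T hT ht1 ht2 hu hl
      have h4 : -1 ≤ t / T := by rw [le_div_iff₀ hT]; linarith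
      have h5 : t / T ≤ 1 := by rw [div_le_one hT]; exact ht2
      have := latticePoint_mem_of_convex hc hu hl (x := (1 + t / T) / 2) (y := (1 - t / T) / 2)
        (by linarith) (by linarith) (by ring)
      convert this using 2
      · field_simp; ring
      · field_simp; ring
    -- The height T of the chord solves s + 2t = 1 on the right half and t - s = 1 on the left half,
    -- with the abscissa 2s + t kept fixed.
    rcases le_total 0 (2 * s + t) with hx | hx
    · refine chord ((2 - (2 * s + t)) / 3) (by linarith) (by linarith) (by linarith) ?_ ?_
      · convert latticePoint_mem_of_convex hc v2 v1 (x := 1 - (2 * s + t)) (y := 2 * s + t)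
          (by linarith) hx (by ring) using 2 <;> ring
      · convert latticePoint_mem_of_convex hc v5 v6 (x := 1 - (2 * s + t)) (y := 2 * s + t)
          (by linarith) hx (by ring) using 2 <;> ring
    · refine chord ((2 + (2 * s + t)) / 3) (by linarith) (by linarith) (by linarith) ?_ ?_
      · convert latticePoint_mem_of_convex hc v2 v3 (x := 1 + (2 * s + t)) (y := -(2 * s + t))
          (by linarith) (by linarith) (by ring) using 2 <;> ring
      · convert latticePoint_mem_of_convex hc v5 v4 (x := 1 + (2 * s + t)) (y := -(2 * s + t))
          (by linarith) (by linarith) (by ring) using 2 <;> ring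

theorem mem_interior_regularHexagon {p : Plane} : p ∈ interior regularHexagon ↔
    |2 * fstCoord p + sndCoord p| < 1 ∧ |fstCoord p + 2 * sndCoord p| < 1 ∧
      |fstCoord p - sndCoord p| < 1 := by
  constructor
  · intro hp
    have h : ∀ a b : ℝ, (a ≠ 0 ∨ b ≠ 0) →
        (∀ q ∈ regularHexagon, |a * fstCoord q + b * sndCoord q| ≤ 1) →
        |a * fstCoord p + b * sndCoord p| < 1 := by
      intro a b hab h
      rw [abs_lt]
      constructor
      · have := lt_of_mem_interior (a := -a) (b := -b) (k := 1) (by simpa using hab)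
          (fun q hq => by linarith [(abs_le.1 (h q hq)).1]) hp
        linarith
      · exact lt_of_mem_interior hab (fun q hq => (abs_le.1 (h q hq)).2) hp
    refine ⟨?_, ?_, ?_⟩
    · simpa using h 2 1 (by norm_num) fun q hq => by simpa using (mem_regularHexagon.1 hq).1
    · simpa using h 1 2 (by norm_num) fun q hq => by simpa using (mem_regularHexagon.1 hq).2.1
    · simpa [← sub_eq_add_neg] using h 1 (-1) (by norm_num) fun q hq => by
        simpa [← sub_eq_add_neg] using (mem_regularHexagon.1 hq).2.2
  · intro hp
    have hopen : IsOpen {p : Plane | |2 * fstCoord p + sndCoord p| < 1 ∧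
        |fstCoord p + 2 * sndCoord p| < 1 ∧ |fstCoord p - sndCoord p| < 1} :=
      (isOpen_lt (f := fun p : Plane => |2 * fstCoord p + sndCoord p|) (g := fun _ => (1 : ℝ))
        (by fun_prop) (by fun_prop)).inter
      ((isOpen_lt (f := fun p : Plane => |fstCoord p + 2 * sndCoord p|) (g := fun _ => (1 : ℝ))
        (by fun_prop) (by fun_prop)).inter
      (isOpen_lt (f := fun p : Plane => |fstCoord p - sndCoord p|) (g := fun _ => (1 : ℝ))
        (by fun_prop) (by fun_prop)))
    exact interior_maximal (fun q hq =>
      mem_regularHexagon.2 ⟨hq.1.le, hq.2.1.le, hq.2.2.le⟩) hopen hp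

theorem convex_regularHexagon : Convex ℝ regularHexagon := convex_convexHull ℝ _

theorem isCompact_regularHexagon : IsCompact regularHexagon :=
  (Set.toFinite _).isCompact_convexHull ℝ

/-- In Cartesian coordinates the open hexagon is the region |y| < (2 - |x|)/√3 over -1 < x < 1. -/
theorem volume_interior_regularHexagon : volume (interior regularHexagon) = ENNReal.ofReal √12 := by
  rw [← volume_preimage_complex (complexFrame 0 1)]
  have hset : complexFrame 0 1 ⁻¹' interior regularHexagon = {z : ℂ | (z.re, z.im) ∈
      regionBetween (fun x => -((2 - |x|) / √3)) (fun x => (2 - |x|) / √3) (Ioo (-1) 1)} := by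
    ext z
    have h0 : complexFrame 0 1 z 0 = z.re := by
      rw [complexFrame_apply]; simp
    have h1 : complexFrame 0 1 z 1 = z.im := by
      rw [complexFrame_apply]; simp
    have h3 : 0 < √3 := by positivity
    simp only [mem_preimage, mem_interior_regularHexagon, regionBetween, mem_ofPred_eq, mem_Ioo,
      fstCoord, sndCoord, h0, h1]
    rw [← neg_div, div_lt_iff₀ h3, lt_div_iff₀ h3]
    have e : z.im / √3 = z.im * √3 / 3 := by
      rw [div_eq_div_iff h3.ne' (by norm_num), mul_assoc, Real.mul_self_sqrt (by norm_num)]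
    rw [e]
    generalize z.im * √3 = y
    generalize z.re = x
    simp only [abs_lt]
    rcases abs_cases x with ⟨hx, hx'⟩ | ⟨hx, hx'⟩ <;> rw [hx]
    all_goals
      constructor
      · rintro ⟨⟨h1, h2⟩, ⟨h3, h4⟩, h5, h6⟩
        refine ⟨⟨?_, ?_⟩, ?_, ?_⟩ <;> linarith
      · rintro ⟨⟨h1, h2⟩, h3, h4⟩
        refine ⟨⟨?_, ?_⟩, ⟨?_, ?_⟩, ?_, ?_⟩ <;> linarith
  rw [hset, volume_complex_eq_prod, Measure.volume_eq_prod, volume_regionBetween_eq_integral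
    ((Continuous.integrableOn_Icc (by fun_prop)).mono_set Ioo_subset_Icc_self)
    ((Continuous.integrableOn_Icc (by fun_prop)).mono_set Ioo_subset_Icc_self)
    measurableSet_Ioo ?_, ← integral_Ioc_eq_integral_Ioo,
    ← intervalIntegral.integral_of_le (by norm_num)]
  · congr 1
    have e : ∀ x : ℝ, ((fun x : ℝ => (2 - |x|) / √3) - fun x : ℝ => -((2 - |x|) / √3)) x =
        (2 - |x|) * (2 / √3) := by
      intro x; simp only [Pi.sub_apply]; ring
    simp_rw [e]
    rw [intervalIntegral.integral_mul_const, ← intervalIntegral.integral_add_adjacent_intervals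
      (b := 0) (Continuous.intervalIntegrable (by fun_prop) _ _)
      (Continuous.intervalIntegrable (by fun_prop) _ _)]
    have i1 : ∫ x : ℝ in (-1)..0, (2 - |x|) = ∫ x : ℝ in (-1)..0, (2 + x) := by
      apply intervalIntegral.integral_congr
      intro x hx
      rw [uIcc_of_le (by norm_num)] at hx
      simp only [abs_of_nonpos hx.2]; ring
    have i2 : ∫ x : ℝ in 0..1, (2 - |x|) = ∫ x : ℝ in 0..1, (2 - x) := by
      apply intervalIntegral.integral_congr
      intro x hx
      rw [uIcc_of_le (by norm_num)] at hx
      simp only [abs_of_nonneg hx.1]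
    have h3 : √3 * √3 = 3 := Real.mul_self_sqrt (by norm_num)
    rw [i1, i2, intervalIntegral.integral_add (by simp) (by simp),
      intervalIntegral.integral_sub (by simp) (by simp), sqrt_twelve]
    simp only [intervalIntegral.integral_const, integral_id, smul_eq_mul]
    field_simp
    nlinarith
  · intro x hx
    have : |x| < 1 := abs_lt.2 hx
    have h3 : 0 < √3 := by positivity
    have : 0 ≤ (2 - |x|) / √3 := by apply div_nonneg <;> linarith
    linarith

theorem volume_frontier_regularHexagon : volume (frontier regularHexagon) = 0 :=
  convex_regularHexagon.addHaar_frontier volume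

theorem zero_mem_interior_regularHexagon : (0 : Plane) ∈ interior regularHexagon := by
  rw [mem_interior_regularHexagon]
  simp [fstCoord, sndCoord]

theorem isBuildingBlock_regularHexagon : IsBuildingBlock regularHexagon where
  isCompact := isCompact_regularHexagon
  nonempty_interior := ⟨0, zero_mem_interior_regularHexagon⟩
  volume_frontier := volume_frontier_regularHexagon

theorem volume_regularHexagon : volume regularHexagon = ENNReal.ofReal √12 := by
  rw [← volume_interior_regularHexagon]
  exact measure_congr (interior_ae_eq_of_null_frontier volume_frontier_regularHexagon).symm

theorem volume_real_regularHexagon : volume.real regularHexagon = √12 := by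
  rw [measureReal_def, volume_regularHexagon, ENNReal.toReal_ofReal (Real.sqrt_nonneg _)]

/-- The squared norm equals (2s + t)² + 3t², (s + 2t)² + 3s² and (s - t)² + 3(s + t)², so each form
is bounded by the norm. -/
theorem closedBall_subset_regularHexagon : closedBall (0 : Plane) 1 ⊆ regularHexagon := by
  intro p hp
  rw [mem_closedBall_zero_iff] at hp
  have h := norm_sq_eq_coords p
  have h1 : ‖p‖ ^ 2 ≤ 1 := by nlinarith [norm_nonneg p]
  rw [mem_regularHexagon]
  generalize fstCoord p = s at *
  generalize sndCoord p = t at *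
  refine ⟨?_, ?_, ?_⟩ <;> apply abs_le_of_sq_le_sq _ zero_le_one
  · nlinarith [sq_nonneg t]
  · nlinarith [sq_nonneg s]
  · nlinarith [sq_nonneg (s + t)]

theorem regularHexagon_subset_closedBall : regularHexagon ⊆ closedBall (0 : Plane) hexRadius := by
  intro p hp
  rw [mem_closedBall_zero_iff]
  have h := norm_sq_eq_coords p
  rw [mem_regularHexagon] at hp
  obtain ⟨h1, h2, h3⟩ := hp
  apply le_of_sq_le_sq _ hexRadius_pos.le
  rw [h, hexRadius_sq]
  generalize fstCoord p = s at *
  generalize sndCoord p = t at *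
  rw [abs_le] at h1 h2 h3
  -- With A = 2s + t, B = s + 2t, C = s - t = A - B, the squared norm is 4/3 times A² - BC = B² + CA
  -- = C² + AB. In each sign pattern one of these is at most a single square.
  rcases le_total 0 (2 * s + t) with ha | ha <;> rcases le_total 0 (s + 2 * t) with hb | hb <;>
    rcases le_total 0 (s - t) with hc | hc <;> nlinarith

/-- The translations by the vectors of the hexagonal lattice. -/
def latticeTranslations : Set (Plane ≃ᵢ Plane) := IsometryEquiv.addRight '' hexagonalPacking

theorem exists_mem_hexagonalPacking_sub_mem (p : Plane) :
    ∃ c ∈ hexagonalPacking, p - c ∈ regularHexagon := by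
  have key : ∃ m n : ℤ, |2 * (fstCoord p - m) + (sndCoord p - n)| ≤ 1 ∧
      |(fstCoord p - m) + 2 * (sndCoord p - n)| ≤ 1 ∧
      |(fstCoord p - m) - (sndCoord p - n)| ≤ 1 := by
    have s0 := Int.floor_le (fstCoord p)
    have s1 := Int.lt_floor_add_one (fstCoord p)
    have t0 := Int.floor_le (sndCoord p)
    have t1 := Int.lt_floor_add_one (sndCoord p)
    generalize ⌊fstCoord p⌋ = m at *
    generalize ⌊sndCoord p⌋ = n at *
    generalize fstCoord p = s at *
    generalize sndCoord p = t at *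
    simp only [abs_le]
    -- The unit parallelogram is divided according to which of its corners has a hexagon containing
    -- the point.
    rcases le_total (t - n) (s - m) with h | h
    · rcases le_total (2 * (s - m) + (t - n)) 1 with h1 | h1
      · refine ⟨m, n, ⟨?_, ?_⟩, ⟨?_, ?_⟩, ?_, ?_⟩ <;> linarith
      · rcases le_total ((s - m) + 2 * (t - n)) 2 with h2 | h2
        · refine ⟨m + 1, n, ⟨?_, ?_⟩, ⟨?_, ?_⟩, ?_, ?_⟩ <;> push_cast <;> linarith
        · refine ⟨m + 1, n + 1, ⟨?_, ?_⟩, ⟨?_, ?_⟩, ?_, ?_⟩ <;> push_cast <;> linarith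
    · rcases le_total ((s - m) + 2 * (t - n)) 1 with h1 | h1
      · refine ⟨m, n, ⟨?_, ?_⟩, ⟨?_, ?_⟩, ?_, ?_⟩ <;> linarith
      · rcases le_total (2 * (s - m) + (t - n)) 2 with h2 | h2
        · refine ⟨m, n + 1, ⟨?_, ?_⟩, ⟨?_, ?_⟩, ?_, ?_⟩ <;> push_cast <;> linarith
        · refine ⟨m + 1, n + 1, ⟨?_, ?_⟩, ⟨?_, ?_⟩, ?_, ?_⟩ <;> push_cast <;> linarith
  obtain ⟨m, n, h⟩ := key
  refine ⟨latticePoint m n, latticePoint_mem_hexagonalPacking m n, ?_⟩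
  rw [mem_regularHexagon]
  simpa using h

theorem interior_isometryEquiv_image (g : Plane ≃ᵢ Plane) (P : Set Plane) :
    interior (g '' P) = g '' interior P :=
  (g.toHomeomorph.image_interior P).symm

theorem isTiling_regularHexagon : IsTiling regularHexagon latticeTranslations where
  covers := by
    refine eq_univ_of_forall fun p => ?_
    obtain ⟨c, hc, hp⟩ := exists_mem_hexagonalPacking_sub_mem p
    exact mem_biUnion (mem_image_of_mem _ hc) ⟨p - c, hp, sub_add_cancel p c⟩
  disjoint := by
    rintro _ ⟨c, hc, rfl⟩ _ ⟨c', hc', rfl⟩ hne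
    have hcc : c ≠ c' := fun h => hne (h ▸ rfl)
    simp only [Function.onFun, interior_isometryEquiv_image]
    rw [Set.disjoint_left]
    rintro _ ⟨p, hp, rfl⟩ ⟨q, hq, hqp⟩
    simp only [IsometryEquiv.addRight_apply] at hqp
    apply hcc
    rw [mem_hexagonalPacking] at hc hc'
    obtain ⟨m, n, hm, hn⟩ := hc
    obtain ⟨m', n', hm', hn'⟩ := hc'
    have e1 := congrArg fstCoord hqp
    have e2 := congrArg sndCoord hqp
    rw [fstCoord_add, fstCoord_add, hm, hm'] at e1
    rw [sndCoord_add, sndCoord_add, hn, hn'] at e2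
    rw [mem_interior_regularHexagon] at hp hq
    simp only [abs_lt] at hp hq
    obtain ⟨⟨a1, a2⟩, ⟨a3, a4⟩, a5, a6⟩ := hp
    obtain ⟨⟨b1, b2⟩, ⟨b3, b4⟩, b5, b6⟩ := hq
    -- Integers a, b with |2a + b|, |a + 2b| and |a - b| all less than 2 are both zero.
    have c1 : ((2 * (m - m') + (n - n') : ℤ) : ℝ) < (2 : ℤ) := by push_cast; linarith
    have c2 : ((-2 : ℤ) : ℝ) < ((2 * (m - m') + (n - n') : ℤ) : ℝ) := by push_cast; linarith
    have c3 : (((m - m') + 2 * (n - n') : ℤ) : ℝ) < (2 : ℤ) := by push_cast; linarith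
    have c4 : ((-2 : ℤ) : ℝ) < (((m - m') + 2 * (n - n') : ℤ) : ℝ) := by push_cast; linarith
    have c5 : (((m - m') - (n - n') : ℤ) : ℝ) < (2 : ℤ) := by push_cast; linarith
    have c6 : ((-2 : ℤ) : ℝ) < (((m - m') - (n - n') : ℤ) : ℝ) := by push_cast; linarith
    rw [Int.cast_lt] at c1 c2 c3 c4 c5 c6
    have h1 : m = m' := by omega
    have h2 : n = n' := by omega
    apply coords_ext
    · rw [hm, hm', h1]
    · rw [hn, hn', h2]

theorem image_zero_latticeTranslations :
    (fun g : Plane ≃ᵢ Plane => g 0) '' latticeTranslations = hexagonalPacking := by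
  rw [latticeTranslations, image_image]
  simp

/-- The discs inscribed in the tiles of a tiling have the same density in each tile. -/
theorem IsTiling.localDensity_image {P : Set Plane} {G : Set (Plane ≃ᵢ Plane)} {c : Plane}
    (hP : IsBuildingBlock P) (hG : IsTiling P G) (hc : closedBall c 1 ⊆ P) {g : Plane ≃ᵢ Plane}
    (hg : g ∈ G) :
    localDensity ((fun g : Plane ≃ᵢ Plane => g c) '' G) (g '' P) = Real.pi / volume.real P := by
  rw [localDensity, volume_real_image_isometryEquiv]
  congr 1
  have hcount : G.Countable :=
    countable_of_injective_of_countable_image (hG.injOn hc) (hG.isPacking hc).countable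
  have himg : ∀ g : Plane ≃ᵢ Plane, closedBall (g c) 1 ⊆ g '' P := fun g => by
    rw [← g.image_closedBall]; exact image_mono hc
  have hball : volume.real (closedBall (g c) 1) = Real.pi := by
    rw [measureReal_def, Measure.addHaar_closedBall_eq_addHaar_ball, ← measureReal_def,
      volume_real_ball _ zero_le_one, one_pow, mul_one]
  rw [← hball]
  apply measureReal_congr
  -- The disc of any other tile can enter this tile only within the null overlap of the two tiles.
  set N := ⋃ g' ∈ G \ {g}, g' '' P ∩ g '' P with hN
  have hN0 : volume N = 0 := by
    rw [hN, measure_biUnion_null_iff (hcount.mono sdiff_subset)]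
    rintro g' ⟨hg', hne⟩
    exact hG.pairwise_aedisjoint hP hg' hg hne
  have h1 : closedBall (g c) 1 ⊆ covered ((fun g : Plane ≃ᵢ Plane => g c) '' G) ∩ g '' P :=
    subset_inter (subset_biUnion_of_mem (u := fun x => closedBall x 1)
      (mem_image_of_mem (fun g : Plane ≃ᵢ Plane => g c) hg)) (himg g)
  have h2 : covered ((fun g : Plane ≃ᵢ Plane => g c) '' G) ∩ g '' P ⊆ closedBall (g c) 1 ∪ N := by
    rintro x ⟨hx, hxg⟩
    obtain ⟨_, ⟨g', hg', rfl⟩, hx'⟩ := mem_iUnion₂.1 hx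
    by_cases he : g' = g
    · subst he; exact Or.inl hx'
    · exact Or.inr (mem_biUnion (⟨hg', he⟩ : g' ∈ G \ {g}) ⟨himg g' hx', hxg⟩)
  refine Filter.EventuallyLE.antisymm ?_ h1.eventuallyLE
  exact h2.eventuallyLE.trans (union_ae_eq_left_of_ae_eq_empty (ae_eq_empty.2 hN0)).le

theorem isUniversalLocalDensity_regularHexagon :
    IsUniversalLocalDensity hexagonalPacking regularHexagon (Real.pi / √12) := by
  refine ⟨isBuildingBlock_regularHexagon, latticeTranslations, isTiling_regularHexagon, ?_⟩
  intro g hg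
  have := isTiling_regularHexagon.localDensity_image isBuildingBlock_regularHexagon
    closedBall_subset_regularHexagon hg
  rwa [image_zero_latticeTranslations, volume_real_regularHexagon] at this

theorem hasGlobalDensity_hexagonalPacking :
    HasGlobalDensity hexagonalPacking (Real.pi / √12) :=
  hasGlobalDensity_of_isUniversalLocalDensity isPacking_hexagonalPacking
    isUniversalLocalDensity_regularHexagon

/-! ### The equilateral triangle -/

theorem mem_equilateralTriangle {p : Plane} : p ∈ equilateralTriangle ↔
    0 ≤ fstCoord p ∧ 0 ≤ sndCoord p ∧ fstCoord p + sndCoord p ≤ 1 := by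
  have e1 : (!₂[(0 : ℝ), 0] : Plane) = latticePoint 0 0 := by
    simp only [latticePoint]; apply plane_ext <;> simp
  have e2 : (!₂[(2 : ℝ), 0] : Plane) = latticePoint 1 0 := by
    simp only [latticePoint]; apply plane_ext <;> simp
  have e3 : (!₂[(1 : ℝ), √3] : Plane) = latticePoint 0 1 := by
    simp only [latticePoint]; apply plane_ext <;> simp
  rw [equilateralTriangle, e1, e2, e3]
  constructor
  · intro hp
    have hsub : convexHull ℝ {latticePoint 0 0, latticePoint 1 0, latticePoint 0 1} ⊆
        {p : Plane | (-1) * fstCoord p + 0 * sndCoord p ≤ 0} ∩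
        ({p | 0 * fstCoord p + (-1) * sndCoord p ≤ 0} ∩
        {p | 1 * fstCoord p + 1 * sndCoord p ≤ 1}) := by
      apply convexHull_min
      · rintro q (rfl | rfl | rfl) <;> simp
      · exact (convex_setOf_coords_le _ _ _).inter
          ((convex_setOf_coords_le _ _ _).inter (convex_setOf_coords_le _ _ _))
    obtain ⟨h1, h2, h3⟩ := hsub hp
    simp only [mem_ofPred_eq] at *
    refine ⟨?_, ?_, ?_⟩ <;> linarith
  · rintro ⟨h1, h2, h3⟩
    have := (convex_convexHull ℝ {latticePoint 0 0, latticePoint 1 0, latticePoint 0 1}).sum_mem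
      (t := Finset.univ) (w := ![1 - fstCoord p - sndCoord p, fstCoord p, sndCoord p])
      (z := ![latticePoint 0 0, latticePoint 1 0, latticePoint 0 1])
      (by intro i _; fin_cases i <;> simp <;> linarith)
      (by simp [Fin.sum_univ_three]; ring)
      (by
        intro i _
        apply subset_convexHull
        fin_cases i <;> simp)
    convert this using 1
    apply coords_ext <;> simp [Fin.sum_univ_three]

theorem interior_equilateralTriangle_subset {p : Plane} (hp : p ∈ interior equilateralTriangle) :
    0 < fstCoord p ∧ 0 < sndCoord p ∧ fstCoord p + sndCoord p < 1 := by
  have h1 := lt_of_mem_interior (a := -1) (b := 0) (k := 0) (by norm_num)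
    (fun q hq => by linarith [(mem_equilateralTriangle.1 hq).1]) hp
  have h2 := lt_of_mem_interior (a := 0) (b := -1) (k := 0) (by norm_num)
    (fun q hq => by linarith [(mem_equilateralTriangle.1 hq).2.1]) hp
  have h3 := lt_of_mem_interior (a := 1) (b := 1) (k := 1) (by norm_num)
    (fun q hq => by linarith [(mem_equilateralTriangle.1 hq).2.2]) hp
  refine ⟨?_, ?_, ?_⟩ <;> linarith

theorem isBuildingBlock_equilateralTriangle : IsBuildingBlock equilateralTriangle where
  isCompact := (Set.toFinite _).isCompact_convexHull ℝ
  nonempty_interior := by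
    refine ⟨latticePoint (1 / 3) (1 / 3), ?_⟩
    have hopen : IsOpen {p : Plane | 0 < fstCoord p ∧ 0 < sndCoord p ∧
        fstCoord p + sndCoord p < 1} :=
      (isOpen_lt (f := fun _ : Plane => (0 : ℝ)) (by fun_prop) continuous_fstCoord).inter
      ((isOpen_lt (f := fun _ : Plane => (0 : ℝ)) (by fun_prop) continuous_sndCoord).inter
      (isOpen_lt (f := fun p : Plane => fstCoord p + sndCoord p) (g := fun _ => (1 : ℝ))
        (by fun_prop) (by fun_prop)))
    refine interior_maximal (fun q hq => mem_equilateralTriangle.2 ⟨hq.1.le, hq.2.1.le, hq.2.2.le⟩)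
      hopen ?_
    simp only [mem_ofPred_eq, fstCoord_latticePoint, sndCoord_latticePoint]
    norm_num
  volume_frontier := (convex_convexHull ℝ _).addHaar_frontier volume

/-- The translations by lattice vectors and the point reflections in the midpoints between
lattice points. -/
def latticeSymmetries : Set (Plane ≃ᵢ Plane) :=
  latticeTranslations ∪ IsometryEquiv.subLeft '' hexagonalPacking

theorem isTiling_equilateralTriangle : IsTiling equilateralTriangle latticeSymmetries where
  covers := by
    refine eq_univ_of_forall fun p => ?_
    have s0 := Int.floor_le (fstCoord p)
    have s1 := Int.lt_floor_add_one (fstCoord p)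
    have t0 := Int.floor_le (sndCoord p)
    have t1 := Int.lt_floor_add_one (sndCoord p)
    generalize ⌊fstCoord p⌋ = m at *
    generalize ⌊sndCoord p⌋ = n at *
    -- The diagonal cuts the unit parallelogram into a translated triangle and a reflected one.
    rcases le_total ((fstCoord p - m) + (sndCoord p - n)) 1 with h | h
    · refine mem_biUnion (Or.inl (mem_image_of_mem _ (latticePoint_mem_hexagonalPacking m n)))
        ⟨p - latticePoint m n, ?_, sub_add_cancel _ _⟩
      rw [mem_equilateralTriangle]
      simp only [fstCoord_sub, sndCoord_sub, fstCoord_latticePoint, sndCoord_latticePoint]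
      refine ⟨?_, ?_, ?_⟩ <;> linarith
    · refine mem_biUnion (Or.inr (mem_image_of_mem _
        (latticePoint_mem_hexagonalPacking (m + 1) (n + 1))))
        ⟨latticePoint ((m + 1 : ℤ) : ℝ) ((n + 1 : ℤ) : ℝ) - p, ?_, sub_sub_cancel _ _⟩
      rw [mem_equilateralTriangle]
      simp only [fstCoord_sub, sndCoord_sub, fstCoord_latticePoint, sndCoord_latticePoint]
      push_cast
      refine ⟨?_, ?_, ?_⟩ <;> linarith
  disjoint := by
    -- A translated and a reflected triangle: a common interior point would give m - m' ≥ 1 and n -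
    -- n' ≥ 1 with sum less than 2.
    have key : ∀ {m n m' n' : ℤ} {p q : Plane}, p ∈ interior equilateralTriangle →
        q ∈ interior equilateralTriangle →
        fstCoord q + m' = m - fstCoord p → sndCoord q + n' = n - sndCoord p → False := by
      intro m n m' n' p q hp hq e1 e2
      obtain ⟨a1, a2, a3⟩ := interior_equilateralTriangle_subset hp
      obtain ⟨b1, b2, b3⟩ := interior_equilateralTriangle_subset hq
      have c1 : ((m' : ℤ) : ℝ) < m := by linarith
      have c2 : ((n' : ℤ) : ℝ) < n := by linarith
      have c3 : ((m + n : ℤ) : ℝ) < (m' + n' + 2 : ℤ) := by push_cast; linarith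
      rw [Int.cast_lt] at c1 c2 c3
      omega
    have same : ∀ {x y : ℝ} {m m' : ℤ}, 0 < x → x < 1 → 0 < y → y < 1 → y + m' = x + m → m = m' := by
      intro x y m m' h1 h2 h3 h4 h5
      have c1 : ((m : ℤ) : ℝ) < (m' + 1 : ℤ) := by push_cast; linarith
      have c2 : ((m' : ℤ) : ℝ) < (m + 1 : ℤ) := by push_cast; linarith
      rw [Int.cast_lt] at c1 c2
      omega
    intro g hg g' hg' hne
    simp only [Function.onFun, interior_isometryEquiv_image]
    rw [Set.disjoint_left]
    rintro _ ⟨p, hp, rfl⟩ ⟨q, hq, hqp⟩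
    obtain ⟨a1, a2, a3⟩ := interior_equilateralTriangle_subset hp
    obtain ⟨b1, b2, b3⟩ := interior_equilateralTriangle_subset hq
    rcases hg with ⟨c, hc, rfl⟩ | ⟨c, hc, rfl⟩ <;> rcases hg' with ⟨c', hc', rfl⟩ | ⟨c', hc', rfl⟩ <;>
      simp only [IsometryEquiv.addRight_apply, IsometryEquiv.subLeft_apply] at hqp <;>
      obtain ⟨m, n, hm, hn⟩ := mem_hexagonalPacking.1 hc <;>
      obtain ⟨m', n', hm', hn'⟩ := mem_hexagonalPacking.1 hc' <;>
      have e1 := congrArg fstCoord hqp <;> have e2 := congrArg sndCoord hqp <;>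
      simp only [fstCoord_add, fstCoord_sub, sndCoord_add, sndCoord_sub, hm, hm', hn, hn'] at e1 e2
    · refine hne (congrArg _ (coords_ext ?_ ?_))
      · rw [hm, hm', same a1 (by linarith) b1 (by linarith) e1]
      · rw [hn, hn', same a2 (by linarith) b2 (by linarith) e2]
    · exact key hq hp e1.symm e2.symm
    · exact key hp hq e1 e2
    · refine hne (congrArg _ (coords_ext ?_ ?_))
      · rw [hm, hm', same (m := m) (m' := m') b1 (by linarith) a1 (by linarith) (by linarith)]
      · rw [hn, hn', same (m := n) (m' := n') b2 (by linarith) a2 (by linarith) (by linarith)]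

theorem image_hexagonalPacking_of_mem_latticeSymmetries {g : Plane ≃ᵢ Plane}
    (hg : g ∈ latticeSymmetries) : g '' hexagonalPacking = hexagonalPacking := by
  rcases hg with ⟨c, hc, rfl⟩ | ⟨c, hc, rfl⟩
  · ext p
    constructor
    · rintro ⟨q, hq, rfl⟩; exact add_mem_hexagonalPacking hq hc
    · intro hp; exact ⟨p - c, sub_mem_hexagonalPacking hp hc, sub_add_cancel _ _⟩
  · ext p
    constructor
    · rintro ⟨q, hq, rfl⟩; exact sub_mem_hexagonalPacking hc hq
    · intro hp; exact ⟨c - p, sub_mem_hexagonalPacking hc hp, sub_sub_cancel _ _⟩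

theorem image_covered (g : Plane ≃ᵢ Plane) (C : Set Plane) : g '' covered C = covered (g '' C) := by
  simp only [covered, image_iUnion, g.image_closedBall, biUnion_image]

theorem localDensity_image (g : Plane ≃ᵢ Plane) (C Q : Set Plane) :
    localDensity (g '' C) (g '' Q) = localDensity C Q := by
  rw [localDensity, localDensity, ← image_covered, ← image_inter g.injective,
    volume_real_image_isometryEquiv, volume_real_image_isometryEquiv]

/-- No area is computed. The symmetries preserve the packing, so the density is the same in every
tile; it is then the global density, already known from the hexagon. -/
theorem isUniversalLocalDensity_equilateralTriangle :
    IsUniversalLocalDensity hexagonalPacking equilateralTriangle (Real.pi / √12) := by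
  have h : IsUniversalLocalDensity hexagonalPacking equilateralTriangle
      (localDensity hexagonalPacking equilateralTriangle) := by
    refine ⟨isBuildingBlock_equilateralTriangle, latticeSymmetries,
      isTiling_equilateralTriangle, fun g hg => ?_⟩
    conv_lhs => rw [← image_hexagonalPacking_of_mem_latticeSymmetries hg]
    exact localDensity_image g _ _
  have := tendsto_nhds_unique
    (hasGlobalDensity_of_isUniversalLocalDensity isPacking_hexagonalPacking h 0)
    (hasGlobalDensity_hexagonalPacking 0)
  rwa [this] at h

/-! ### The hexagon is a Kepler building block -/

/-- Precomposing each motion with the inverse of `e` leaves the tiles unchanged as sets. -/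
theorem IsTiling.image {P : Set Plane} {G : Set (Plane ≃ᵢ Plane)} (hG : IsTiling P G)
    (e : Plane ≃ᵢ Plane) : IsTiling (e '' P) ((fun g => e.symm.trans g) '' G) where
  covers := by
    rw [biUnion_image, ← hG.covers]
    simp [image_image]
  disjoint := by
    rintro _ ⟨g, hg, rfl⟩ _ ⟨g', hg', rfl⟩ hne
    have h := hG.disjoint hg hg' (fun h => hne (h ▸ rfl))
    simpa [Function.onFun, image_image] using h

theorem isUnitDiscTile_image_regularHexagon (e : Plane ≃ᵢ Plane) :
    IsUnitDiscTile (e '' regularHexagon) where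
  block := isBuildingBlock_regularHexagon.image e
  contains_disc := ⟨e 0, by
    rw [← e.image_closedBall]; exact image_mono closedBall_subset_regularHexagon⟩
  tiles := ⟨_, isTiling_regularHexagon.image e⟩

theorem isKeplerBlock_image_regularHexagon (e : Plane ≃ᵢ Plane) :
    IsKeplerBlock (e '' regularHexagon) where
  tile := isUnitDiscTile_image_regularHexagon e
  least_area := by
    intro Q hQ
    rw [volume_image_isometryEquiv, volume_regularHexagon]
    exact (ENNReal.ofReal_le_iff_le_toReal hQ.block.isCompact.measure_lt_top.ne).2 hQ.sqrt_twelve_le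

theorem isUnitDiscTile_regularHexagon : IsUnitDiscTile regularHexagon := by
  have := isUnitDiscTile_image_regularHexagon (IsometryEquiv.refl Plane)
  rwa [show ⇑(IsometryEquiv.refl Plane) = id from rfl, image_id] at this

theorem IsKeplerBlock.volume_real_le {P : Set Plane} (hP : IsKeplerBlock P) :
    volume.real P ≤ √12 := by
  rw [← volume_real_regularHexagon]
  exact ENNReal.toReal_mono isCompact_regularHexagon.measure_lt_top.ne
    (hP.least_area _ isUnitDiscTile_regularHexagon)

/-! ### Six discs touching a given one -/

theorem norm_sub_sq_of_norm_one {a b : ℂ} (ha : ‖a‖ = 1) (hb : ‖b‖ = 1) :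
    ‖a - b‖ ^ 2 = 2 - 2 * Real.cos (a.arg - b.arg) := by
  have h1 := Complex.norm_mul_cos_arg a
  have h2 := Complex.norm_mul_sin_arg a
  have h3 := Complex.norm_mul_cos_arg b
  have h4 := Complex.norm_mul_sin_arg b
  rw [ha, one_mul] at h1 h2
  rw [hb, one_mul] at h3 h4
  rw [← Complex.normSq_eq_norm_sq, Complex.normSq_apply, Real.cos_sub, h1, h2, h3, h4]
  have h5 : a.re ^ 2 + a.im ^ 2 = 1 := by
    rw [← h1, ← h2]; exact Real.cos_sq_add_sin_sq _
  have h6 : b.re ^ 2 + b.im ^ 2 = 1 := by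
    rw [← h3, ← h4]; exact Real.cos_sq_add_sin_sq _
  simp only [Complex.sub_re, Complex.sub_im]
  linarith

theorem pi_div_three_le_abs_arg_sub {a b : ℂ} (ha : ‖a‖ = 1) (hb : ‖b‖ = 1) (h : 1 ≤ ‖a - b‖) :
    Real.pi / 3 ≤ |a.arg - b.arg| := by
  by_contra! hlt
  have h1 : 1 / 2 < Real.cos (a.arg - b.arg) := by
    rw [← Real.cos_abs, ← Real.cos_pi_div_three]
    exact Real.cos_lt_cos_of_nonneg_of_le_pi (abs_nonneg _) (by linarith [Real.pi_pos]) hlt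
  have h2 := norm_sub_sq_of_norm_one ha hb
  nlinarith

/-- Six points on the unit circle at mutual distances at least one, one of which is `1`: then the
point at angle `π / 3` is among them. -/
theorem exists_arg_eq_pi_div_three {f : Fin 6 → ℂ} (hf : ∀ i, ‖f i‖ = 1)
    (hd : ∀ i j, i ≠ j → 1 ≤ ‖f i - f j‖) {i₀ : Fin 6} (h0 : f i₀ = 1) :
    ∃ i, (f i).arg = Real.pi / 3 := by
  have hπ : 0 < Real.pi / 3 := by positivity
  -- The circle is cut into six half-open arcs of length π/3. No two points share an arc, so each
  -- arc contains exactly one.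
  set k : Fin 6 → ℤ := fun i => ⌈(f i).arg / (Real.pi / 3)⌉ with hk
  have hinj : Function.Injective k := by
    intro i j hij
    by_contra hne
    have h := pi_div_three_le_abs_arg_sub (hf i) (hf j) (hd i j hne)
    have h1 : |(f i).arg / (Real.pi / 3) - (f j).arg / (Real.pi / 3)| < 1 := by
      have a1 := Int.le_ceil ((f i).arg / (Real.pi / 3))
      have a2 := Int.ceil_lt_add_one ((f i).arg / (Real.pi / 3))
      have b1 := Int.le_ceil ((f j).arg / (Real.pi / 3))
      have b2 := Int.ceil_lt_add_one ((f j).arg / (Real.pi / 3))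
      simp only [hk] at hij
      rw [hij] at a1 a2
      rw [abs_lt]
      constructor <;> linarith
    rw [← sub_div, abs_div, abs_of_pos hπ, div_lt_one hπ] at h1
    exact absurd h (not_le.2 h1)
  have hmaps : ∀ i, k i ∈ Finset.Icc (-2 : ℤ) 3 := by
    intro i
    have h1 := Complex.neg_pi_lt_arg (f i)
    have h2 := Complex.arg_le_pi (f i)
    rw [Finset.mem_Icc]
    constructor
    · have : (-3 : ℤ) < k i := by
        rw [hk]; simp only
        rw [Int.lt_ceil, lt_div_iff₀ hπ]; push_cast; linarith
      omega
    · rw [hk]; simp only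
      rw [Int.ceil_le, div_le_iff₀ hπ]; push_cast; linarith
  have hsurj : Finset.univ.image k = Finset.Icc (-2 : ℤ) 3 := by
    apply Finset.eq_of_subset_of_card_le
    · intro x hx
      obtain ⟨i, -, rfl⟩ := Finset.mem_image.1 hx
      exact hmaps i
    · rw [Finset.card_image_of_injective _ hinj]; simp
  -- The arc (0, π/3] contains a point, and separation from the point `1` at argument 0 pushes it to
  -- the endpoint π/3.
  have h1 : (1 : ℤ) ∈ Finset.univ.image k := by rw [hsurj]; simp
  obtain ⟨i, -, hi⟩ := Finset.mem_image.1 h1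
  refine ⟨i, ?_⟩
  rw [hk] at hi
  simp only at hi
  rw [Int.ceil_eq_iff] at hi
  push_cast at hi
  have hpos : 0 < (f i).arg := by
    have := hi.1
    rw [sub_self] at this
    by_contra hn
    exact absurd (div_nonpos_of_nonpos_of_nonneg (not_lt.1 hn) hπ.le) (not_le.2 this)
  have hle : (f i).arg ≤ Real.pi / 3 := by
    have := hi.2
    rwa [div_le_one hπ] at this
  have hne : i ≠ i₀ := by
    rintro rfl
    rw [h0, Complex.arg_one] at hpos
    exact lt_irrefl _ hpos
  have h2 := pi_div_three_le_abs_arg_sub (hf i) (hf i₀) (hd i i₀ hne)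
  rw [h0, Complex.arg_one, sub_zero, abs_of_pos hpos] at h2
  exact le_antisymm hle h2

/-- The rotation of the plane by the angle `π / 3`. -/
def rotSixty (p : Plane) : Plane := latticePoint (-sndCoord p) (fstCoord p + sndCoord p)

@[simp] theorem fstCoord_rotSixty (p : Plane) : fstCoord (rotSixty p) = -sndCoord p := by
  simp [rotSixty]

@[simp] theorem sndCoord_rotSixty (p : Plane) :
    sndCoord (rotSixty p) = fstCoord p + sndCoord p := by
  simp [rotSixty]

theorem fstCoord_repr (z : ℂ) :
    fstCoord (Complex.orthonormalBasisOneI.repr z) = (z.re - z.im / √3) / 2 := by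
  simp [fstCoord]

theorem sndCoord_repr (z : ℂ) :
    sndCoord (Complex.orthonormalBasisOneI.repr z) = z.im / √3 := by
  simp [sndCoord]

theorem repr_mul_exp_pi_div_three (z : ℂ) : Complex.orthonormalBasisOneI.repr
    (z * Complex.exp ((Real.pi / 3 : ℝ) * Complex.I)) =
      rotSixty (Complex.orthonormalBasisOneI.repr z) := by
  have h3 : 0 < √3 := by positivity
  have hs : √3 ^ 2 = 3 := Real.sq_sqrt (by norm_num)
  have h1 : (z * Complex.exp ((Real.pi / 3 : ℝ) * Complex.I)).re = z.re / 2 - z.im * √3 / 2 := by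
    rw [Complex.mul_re, Complex.exp_ofReal_mul_I_re, Complex.exp_ofReal_mul_I_im,
      Real.cos_pi_div_three, Real.sin_pi_div_three]
    ring
  have h2 : (z * Complex.exp ((Real.pi / 3 : ℝ) * Complex.I)).im = z.re * √3 / 2 + z.im / 2 := by
    rw [Complex.mul_im, Complex.exp_ofReal_mul_I_re, Complex.exp_ofReal_mul_I_im,
      Real.cos_pi_div_three, Real.sin_pi_div_three]
    ring
  apply coords_ext
  · rw [fstCoord_rotSixty, fstCoord_repr, sndCoord_repr, h1, h2]
    field_simp
    linear_combination (-z.im) * hs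
  · rw [sndCoord_rotSixty, fstCoord_repr, sndCoord_repr, sndCoord_repr, h2]
    field_simp
    ring

/-- Six points on a circle of radius two at mutual distances at least two form a regular
hexagon. -/
theorem exists_eq_rotSixty {f : Fin 6 → Plane} (hf : ∀ i, ‖f i‖ = 2)
    (hd : ∀ i j, i ≠ j → 2 ≤ dist (f i) (f j)) (i₀ : Fin 6) : ∃ i, f i = rotSixty (f i₀) := by
  set J := Complex.orthonormalBasisOneI.repr
  set u := J.symm (f i₀) with hu
  have hun : ‖u‖ = 2 := by rw [hu, LinearIsometryEquiv.norm_map, hf]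
  have hu0 : u ≠ 0 := by rw [← norm_pos_iff, hun]; norm_num
  have hn : ∀ i, ‖J.symm (f i) / u‖ = 1 := by
    intro i; rw [norm_div, LinearIsometryEquiv.norm_map, hf, hun]; norm_num
  obtain ⟨i, hi⟩ := exists_arg_eq_pi_div_three (f := fun i => J.symm (f i) / u) (i₀ := i₀) hn
    (by
      intro i j hij
      rw [← sub_div, norm_div, ← map_sub, LinearIsometryEquiv.norm_map, hun, ← dist_eq_norm,
        le_div_iff₀ (by norm_num), one_mul]
      exact hd i j hij)
    (div_self hu0)
  refine ⟨i, ?_⟩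
  have h1 := Complex.norm_mul_exp_arg_mul_I (J.symm (f i) / u)
  rw [hn, hi, Complex.ofReal_one, one_mul, eq_div_iff hu0] at h1
  rw [← J.apply_symm_apply (f i), ← h1, mul_comm, repr_mul_exp_pi_div_three, hu,
    LinearIsometryEquiv.apply_symm_apply]

theorem exists_isometryEquiv_of_dist_eq_two {c q : Plane} (h : dist c q = 2) :
    ∃ e : Plane ≃ᵢ Plane, e 0 = c ∧ e (latticePoint 1 0) = q := by
  obtain ⟨u, hu⟩ := exists_complexFrame (p := c) (q := q) (dist_pos.1 (by rw [h]; norm_num))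
  have h0 : (complexFrame 0 1).symm 0 = 0 := by
    rw [IsometryEquiv.symm_apply_eq, complexFrame_zero]
  have h1 : (complexFrame 0 1).symm (latticePoint 1 0) = ((2 : ℝ) : ℂ) := by
    rw [IsometryEquiv.symm_apply_eq, complexFrame_apply]
    apply coords_ext
    · simp [fstCoord_repr]
    · simp [sndCoord_repr]
  refine ⟨(complexFrame 0 1).symm.trans (complexFrame c u), ?_, ?_⟩
  · rw [IsometryEquiv.trans_apply, h0, complexFrame_zero]
  · rw [IsometryEquiv.trans_apply, h1, ← h, hu]

/-- The perpendicular bisectors between 0 and the six shortest lattice vectors bound the hexagon. -/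
theorem mem_regularHexagon_of_norm_le {p : Plane}
    (h : ∀ q ∈ ({latticePoint 1 0, latticePoint 0 1, latticePoint (-1) 1, latticePoint (-1) 0,
      latticePoint 0 (-1), latticePoint 1 (-1)} : Set Plane), dist p 0 ≤ dist p q) :
    p ∈ regularHexagon := by
  have key : ∀ a b : ℝ, a ^ 2 + a * b + b ^ 2 = 1 → dist p 0 ≤ dist p (latticePoint a b) →
      (2 * fstCoord p + sndCoord p) * a + (fstCoord p + 2 * sndCoord p) * b ≤ 1 := by
    intro a b hab hle
    have h1 := norm_sq_eq_coords (p - latticePoint a b)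
    have h2 := norm_sq_eq_coords p
    simp only [fstCoord_sub, sndCoord_sub, fstCoord_latticePoint, sndCoord_latticePoint] at h1
    rw [dist_zero_right, dist_eq_norm] at hle
    have h3 : ‖p‖ ^ 2 ≤ ‖p - latticePoint a b‖ ^ 2 := by gcongr
    rw [h1, h2] at h3
    linarith
  have k1 := key 1 0 (by norm_num) (h _ (by simp))
  have k2 := key 0 1 (by norm_num) (h _ (by simp))
  have k3 := key (-1) 1 (by norm_num) (h _ (by simp))
  have k4 := key (-1) 0 (by norm_num) (h _ (by simp))
  have k5 := key 0 (-1) (by norm_num) (h _ (by simp))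
  have k6 := key 1 (-1) (by norm_num) (h _ (by simp))
  rw [mem_regularHexagon]
  refine ⟨abs_le.2 ⟨?_, ?_⟩, abs_le.2 ⟨?_, ?_⟩, abs_le.2 ⟨?_, ?_⟩⟩ <;> linarith

theorem forall_hexagon_of_rotSixty {A : Plane → Prop} (h0 : A (latticePoint 1 0))
    (h : ∀ p, A p → A (rotSixty p)) :
    ∀ q ∈ ({latticePoint 1 0, latticePoint 0 1, latticePoint (-1) 1, latticePoint (-1) 0,
      latticePoint 0 (-1), latticePoint 1 (-1)} : Set Plane), A q := by
  have step : ∀ a b a' b' : ℝ, a' = -b → b' = a + b → A (latticePoint a b) →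
      A (latticePoint a' b') := by
    rintro a b _ _ rfl rfl hA
    have := h _ hA
    rwa [rotSixty, fstCoord_latticePoint, sndCoord_latticePoint] at this
  have h1 := step 1 0 0 1 (by norm_num) (by norm_num) h0
  have h2 := step 0 1 (-1) 1 (by norm_num) (by norm_num) h1
  have h3 := step (-1) 1 (-1) 0 (by norm_num) (by norm_num) h2
  have h4 := step (-1) 0 0 (-1) (by norm_num) (by norm_num) h3
  have h5 := step 0 (-1) 1 (-1) (by norm_num) (by norm_num) h4
  rintro q (rfl | rfl | rfl | rfl | rfl | rfl) <;> assumption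

/-- The Voronoi cell of the centre of a disc touched by six others is a regular hexagon. -/
theorem exists_subset_image_regularHexagon {P : Set Plane} {c : Plane} {q : Fin 6 → Plane}
    (hq : ∀ i, dist c (q i) = 2) (hd : ∀ i j, i ≠ j → 2 ≤ dist (q i) (q j))
    (hP : ∀ x ∈ P, ∀ i, dist x c ≤ dist x (q i)) :
    ∃ e : Plane ≃ᵢ Plane, P ⊆ e '' regularHexagon := by
  obtain ⟨e, he0, he1⟩ := exists_isometryEquiv_of_dist_eq_two (hq 0)
  refine ⟨e, fun x hx => ⟨e.symm x, ?_, e.apply_symm_apply x⟩⟩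
  -- In normalised position the set of touching centres contains (2, 0) and is closed under the
  -- rotation by π/3, so it contains all six shortest lattice vectors.
  have hall := forall_hexagon_of_rotSixty (A := fun p => ∃ i, e.symm (q i) = p)
    ⟨0, by rw [IsometryEquiv.symm_apply_eq, he1]⟩ (by
      rintro _ ⟨i, rfl⟩
      apply exists_eq_rotSixty (f := fun i => e.symm (q i))
      · intro i
        rw [← dist_zero_left, ← e.dist_eq, he0, e.apply_symm_apply, hq]
      · intro i j hij
        rw [e.symm.dist_eq]; exact hd i j hij)
  apply mem_regularHexagon_of_norm_le
  intro p hp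
  obtain ⟨i, rfl⟩ := hall p hp
  rw [e.symm.dist_eq, ← e.dist_eq, he0, e.apply_symm_apply]
  exact hP x hx i

/-! ### Convex Kepler building blocks -/

/-- The contact point m of the two discs lies in `P`. If `x` were nearer to `q` than to `c`, the
segment from m to `x` would enter the open disc around `q` at once; but a convex set with interior
lies in the closure of its interior, which misses that disc. -/
theorem dist_le_of_convex {P : Set Plane} (hconv : Convex ℝ P) {c q : Plane}
    (hc : closedBall c 1 ⊆ P) (hcq : dist c q = 2) (hdisj : Disjoint (interior P) (ball q 1))
    {x : Plane} (hx : x ∈ P) : dist x c ≤ dist x q := by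
  have hint : (interior P).Nonempty :=
    ⟨c, interior_maximal (ball_subset_closedBall.trans hc) isOpen_ball (mem_ball_self one_pos)⟩
  have hdisj' : Disjoint (closure (interior P)) (ball q 1) := hdisj.closure_left isOpen_ball
  rw [hconv.closure_interior_eq_closure_of_nonempty_interior hint] at hdisj'
  by_contra! hlt
  set m : Plane := (1 / 2 : ℝ) • (c + q) with hm
  have hmP : m ∈ P := by
    apply hc
    rw [mem_closedBall, dist_eq_norm, hm, show (1 / 2 : ℝ) • (c + q) - c = (1 / 2 : ℝ) • (q - c) by
      module, norm_smul, ← dist_eq_norm, dist_comm, hcq]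
    norm_num
  -- This is twice the inner product of x - m and q - m. On the segment the squared distance to `q`
  -- is 1 + l(lM - k), so a positive l ≤ 1 with lM < k is wanted.
  set k := (dist x c ^ 2 - dist x q ^ 2) / 2 with hk
  have hk0 : 0 < k := by
    have : dist x q ^ 2 < dist x c ^ 2 := by gcongr
    rw [hk]; linarith
  set M := dist x m ^ 2 with hM
  have hM0 : 0 ≤ M := sq_nonneg _
  set l := k / (k + M + 1) with hl
  have hl0 : 0 < l := by positivity
  have hl1 : l ≤ 1 := by rw [hl, div_le_one (by positivity)]; linarith
  have hlM : l * M < k := by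
    rw [hl, div_mul_eq_mul_div, div_lt_iff₀ (by positivity)]
    nlinarith
  have hz := hconv hmP hx (sub_nonneg.2 hl1) hl0.le (sub_add_cancel 1 l)
  set z := (1 - l) • m + l • x
  have hzd : dist z q ^ 2 = 1 + l * (l * M - k) := by
    have e : dist z q ^ 2 = 1 + l * (l * M - k) +
        (dist c q ^ 2 - 4) * (1 / 4) := by
      simp only [z, hk, hM, hm, EuclideanSpace.dist_eq, Fin.sum_univ_two]
      repeat rw [Real.sq_sqrt (by positivity)]
      simp only [Real.dist_eq, sq_abs, PiLp.add_apply, PiLp.smul_apply, smul_eq_mul]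
      ring
    rw [e, hcq]; ring
  have hz1 : dist z q < 1 := by
    have : l * (l * M - k) < 0 := mul_neg_of_pos_of_neg hl0 (by linarith)
    nlinarith [dist_nonneg (x := z) (y := q)]
  exact hdisj'.le_bot ⟨subset_closure hz, hz1⟩

/-- The interior of `Q` minus `P` is open and null, hence empty; taking closures gives all of `Q`.
-/
theorem eq_of_subset_of_volume_le {P Q : Set Plane} (hPc : IsClosed P) (hPQ : P ⊆ Q)
    (hQ : Q ⊆ closure (interior Q)) (hfin : volume P ≠ ⊤) (hle : volume Q ≤ volume P) : P = Q := by
  apply hPQ.antisymm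
  have h0 : volume (interior Q \ P) = 0 := by
    refine measure_mono_null (sdiff_subset_sdiff_left interior_subset) ?_
    rw [measure_sdiff hPQ hPc.measurableSet.nullMeasurableSet hfin]
    exact tsub_eq_zero_of_le hle
  have h1 : interior Q \ P = ∅ := by
    by_contra hne
    exact (isOpen_interior.sdiff hPc).measure_ne_zero volume (nonempty_iff_ne_empty.2 hne) h0
  exact hQ.trans (closure_minimal (sdiff_eq_empty.1 h1) hPc)

/-- The interior of a Kepler building block containing the disc around `c` misses six unit discs
which touch that disc. -/
theorem IsKeplerBlock.exists_six_touching {P : Set Plane} {c : Plane} (hP : IsKeplerBlock P)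
    (hc : closedBall c 1 ⊆ P) : ∃ q : Fin 6 → Plane, (∀ i, dist c (q i) = 2) ∧
      (∀ i j, i ≠ j → 2 ≤ dist (q i) (q j)) ∧ ∀ i, Disjoint (interior P) (ball (q i) 1) := by
  obtain ⟨G, hG⟩ := hP.tile.tiles
  have hr : 21 / 10 < 2 * hexRadius := by nlinarith [hexRadius_sq, hexRadius_pos]
  -- The nearly extremal tile varies with n, so each configuration is moved back to the fixed block
  -- `P`. The bound 2 + 1/10 stays below 2r.
  have step : ∀ n : ℕ, ∃ q : Fin 6 → Plane, (∀ i, 2 ≤ dist c (q i)) ∧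
      (∀ i, dist c (q i) < 2 + 1 / 10 * (1 / ((n : ℝ) + 1))) ∧
      (∀ i j, i ≠ j → 2 ≤ dist (q i) (q j)) ∧ ∀ i, Disjoint (interior P) (ball (q i) 1) := by
    intro n
    have hn : 1 / ((n : ℝ) + 1) ≤ 1 := by
      rw [div_le_one (by positivity)]; linarith [n.cast_nonneg (α := ℝ)]
    have hn0 : 0 < 1 / ((n : ℝ) + 1) := by positivity
    obtain ⟨g, hg, hcard⟩ := hG.exists_six_near hP.tile.block hc hP.volume_real_le
      (d := 2 + 1 / 10 * (1 / ((n : ℝ) + 1))) (by linarith) (by linarith)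
    obtain ⟨t, ht, htc⟩ := exists_subset_card_eq hcard
    -- `ncard` is 0 for infinite sets, so a positive value ensures finiteness.
    have htf : t.Finite := finite_of_ncard_pos (by omega)
    have : Nonempty (Fin 6 ↪ t) := by
      have := htf.fintype
      apply Function.Embedding.nonempty_of_card_le
      rw [Fintype.card_fin, ← Nat.card_eq_fintype_card, Nat.card_coe_set_eq, htc]
    obtain ⟨f⟩ := this
    have hf : ∀ i, ∃ g' ∈ G, g' ≠ g ∧ g' c = f i := by
      intro i
      obtain ⟨⟨g', hg', h1⟩, h2, -⟩ := ht (f i).2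
      exact ⟨g', hg', fun h => h2 (h ▸ h1.symm), h1⟩
    refine ⟨fun i => g.symm (f i), ?_, ?_, ?_, ?_⟩
    · intro i
      obtain ⟨g', hg', hne, h⟩ := hf i
      rw [← g.dist_eq, g.apply_symm_apply, ← h]
      exact hG.two_le_dist hc hg hg' hne.symm
    · intro i
      rw [← g.dist_eq, g.apply_symm_apply]
      exact (ht (f i).2).2.2
    · intro i j hij
      rw [g.symm.dist_eq]
      exact (hG.isPacking hc).two_le_dist (ht (f i).2).1 (ht (f j).2).1
        (fun h => hij (f.injective (Subtype.ext h)))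
    · intro i
      obtain ⟨g', hg', hne, h⟩ := hf i
      have h1 := (hG.disjoint hg' hg hne).mono_left (ball_subset_interior_image hc g')
      simp only [interior_isometryEquiv_image, h] at h1
      rw [← g.symm.image_ball]
      rw [Set.disjoint_left] at h1 ⊢
      rintro x hx ⟨y, hy, rfl⟩
      exact h1 hy ⟨_, hx, g.apply_symm_apply y⟩
  choose q hq1 hq2 hq3 hq4 using step
  have hlim0 : Tendsto (fun n : ℕ => 2 + 1 / 10 * (1 / ((n : ℝ) + 1))) atTop (𝓝 2) := by
    have := (tendsto_one_div_add_atTop_nhds_zero_nat (𝕜 := ℝ)).const_mul (1 / 10)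
    simpa using this.const_add 2
  have hbdd : ∀ n, q n ∈ closedBall (fun _ => c : Fin 6 → Plane) 3 := by
    intro n
    rw [mem_closedBall, dist_pi_le_iff (by norm_num)]
    intro i
    have hn : 1 / ((n : ℝ) + 1) ≤ 1 := by
      rw [div_le_one (by positivity)]; linarith [n.cast_nonneg (α := ℝ)]
    rw [dist_comm]
    linarith [hq2 n i]
  -- Compactness in the sixfold product of the plane; the separation, contact and disjointness
  -- conditions all pass to the limit.
  obtain ⟨Q, -, φ, hφ, hQ⟩ := tendsto_subseq_of_bounded isBounded_closedBall hbdd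
  have hQi : ∀ i, Tendsto (fun n => q (φ n) i) atTop (𝓝 (Q i)) := fun i =>
    (tendsto_pi_nhds.1 hQ) i
  refine ⟨Q, ?_, ?_, ?_⟩
  · intro i
    have h1 : Tendsto (fun n => dist c (q (φ n) i)) atTop (𝓝 (dist c (Q i))) :=
      tendsto_const_nhds.dist (hQi i)
    apply le_antisymm
    · exact le_of_tendsto_of_tendsto' h1 (hlim0.comp hφ.tendsto_atTop) fun n => (hq2 (φ n) i).le
    · exact ge_of_tendsto' h1 fun n => hq1 (φ n) i
  · intro i j hij
    exact ge_of_tendsto' ((hQi i).dist (hQi j)) fun n => hq3 (φ n) i j hij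
  · intro i
    rw [Set.disjoint_left]
    intro x hx hxQ
    have h1 : Tendsto (fun n => dist x (q (φ n) i)) atTop (𝓝 (dist x (Q i))) :=
      tendsto_const_nhds.dist (hQi i)
    obtain ⟨n, hn⟩ := (h1.eventually (gt_mem_nhds hxQ)).exists
    exact (hq4 (φ n) i).le_bot ⟨hx, hn⟩

/-- A convex Kepler building block is congruent to the regular hexagon. -/
theorem IsKeplerBlock.exists_eq_image_regularHexagon {P : Set Plane} (hconv : Convex ℝ P)
    (hP : IsKeplerBlock P) : ∃ e : Plane ≃ᵢ Plane, P = e '' regularHexagon := by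
  obtain ⟨c, hc⟩ := hP.tile.contains_disc
  obtain ⟨q, hq1, hq2, hq3⟩ := hP.exists_six_touching hc
  obtain ⟨e, he⟩ := exists_subset_image_regularHexagon hq1 hq2
    fun x hx i => dist_le_of_convex hconv hc (hq1 i) (hq3 i) hx
  refine ⟨e, eq_of_subset_of_volume_le hP.tile.block.isCompact.isClosed he ?_
    hP.tile.block.isCompact.measure_lt_top.ne ?_⟩
  · have h1 : regularHexagon ⊆ closure (interior regularHexagon) := by
      rw [convex_regularHexagon.closure_interior_eq_closure_of_nonempty_interior
        ⟨0, zero_mem_interior_regularHexagon⟩]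
      exact subset_closure
    rw [interior_isometryEquiv_image]
    exact (image_mono h1).trans (image_closure_subset_closure_image e.continuous)
  · rw [volume_image_isometryEquiv, volume_regularHexagon]
    exact (ENNReal.ofReal_le_iff_le_toReal hP.tile.block.isCompact.measure_lt_top.ne).2
      hP.tile.sqrt_twelve_le

/-! ### Packings whose enlarged discs cover the plane -/

section Covering

variable {S : Set Plane}

/-- If the discs of radius `hexRadius` cover the plane, then at a point of the boundary of two of
them from which one can leave both, there is a third one. -/
theorem exists_third (hS : IsPacking S) (hcov : ∀ p, ∃ s ∈ S, dist p s ≤ hexRadius) {a b p w : Plane}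
    (hw : w ≠ 0) (ha : dist p a = hexRadius) (hb : dist p b = hexRadius)
    (hwa : 0 ≤ inner ℝ w (p - a)) (hwb : 0 ≤ inner ℝ w (p - b)) :
    ∃ q ∈ S, q ≠ a ∧ q ≠ b ∧ dist p q ≤ hexRadius := by
  by_contra! hcon
  have hr := hexRadius_pos
  -- The radius 10 is generous: a centre covering a point within 1 of `p` is itself within 1 + 6/5.
  -- Finitely many other centres all stay too far under a small enough displacement.
  have hfin : ((S ∩ ball p 10) \ {a, b}).Finite := (hS.finite_inter_ball p 10).sdiff
  have hlim : Tendsto (fun t : ℝ => p + t • w) (𝓝[>] 0) (𝓝 p) := by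
    have : Continuous fun t : ℝ => p + t • w := by fun_prop
    have h0 := this.tendsto 0
    simp only [zero_smul, add_zero] at h0
    exact h0.mono_left nhdsWithin_le_nhds
  have h1 : ∀ᶠ t : ℝ in 𝓝[>] 0, ∀ q ∈ (S ∩ ball p 10) \ {a, b},
      hexRadius < dist (p + t • w) q := by
    rw [eventually_all_finite hfin]
    rintro q ⟨⟨hq, -⟩, hqab⟩
    rw [mem_insert_iff, mem_singleton_iff, not_or] at hqab
    exact (hlim.dist tendsto_const_nhds).eventually (lt_mem_nhds (hcon q hq hqab.1 hqab.2))
  have h2 : ∀ᶠ t : ℝ in 𝓝[>] 0, dist (p + t • w) p < 1 :=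
    hlim.eventually (ball_mem_nhds p one_pos)
  obtain ⟨t, ⟨ht1, ht2⟩, ht0⟩ := ((h1.and h2).and self_mem_nhdsWithin).exists
  have ht : 0 < t := ht0
  -- Along `w` the squared distance grows strictly: its linear term is nonnegative and its quadratic
  -- term positive.
  have far : ∀ x : Plane, dist p x = hexRadius → 0 ≤ inner ℝ w (p - x) →
      hexRadius < dist (p + t • w) x := by
    intro x hx hwx
    apply lt_of_pow_lt_pow_left₀ 2 dist_nonneg
    rw [dist_eq_norm, show p + t • w - x = (p - x) + t • w by abel, norm_add_sq_real,
      ← dist_eq_norm, hx, inner_smul_right, real_inner_comm, norm_smul]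
    have hw0 : 0 < ‖w‖ := norm_pos_iff.2 hw
    have : 0 < (‖t‖ * ‖w‖) ^ 2 := by
      have := norm_pos_iff.2 ht.ne'
      positivity
    nlinarith [mul_nonneg ht.le hwx]
  obtain ⟨s, hs, hsd⟩ := hcov (p + t • w)
  by_cases hsab : s ∈ ({a, b} : Set Plane)
  · rcases hsab with rfl | rfl
    · exact absurd hsd (not_le.2 (far _ ha hwa))
    · exact absurd hsd (not_le.2 (far _ hb hwb))
  · refine absurd hsd (not_le.2 (ht1 s ⟨⟨hs, ?_⟩, hsab⟩))
    rw [mem_ball]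
    linarith [dist_triangle_left s p (p + t • w), hexRadius_lt]

/-- Three centres within the distance `hexRadius` from `p` form an equilateral triangle with
centre `p`. -/
theorem IsPacking.equilateral (hS : IsPacking S) {a b q p : Plane} (ha : a ∈ S) (hb : b ∈ S)
    (hq : q ∈ S) (hab : a ≠ b) (hqa : q ≠ a) (hqb : q ≠ b) (hpa : dist p a ≤ hexRadius)
    (hpb : dist p b ≤ hexRadius) (hpq : dist p q ≤ hexRadius) :
    dist a b = 2 ∧ q = (3 : ℝ) • p - a - b := by
  -- The squared sides sum to at least 12 and at most 3 · 3 · 4/3 = 12 minus the squared norm, so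
  -- equality holds throughout.
  have h := sum_dist_sq_eq p a b q
  have h1 := hS.two_le_dist ha hb hab
  have h2 := hS.two_le_dist hb hq hqb.symm
  have h3 := hS.two_le_dist hq ha hqa
  have sq : ∀ x, dist p x ≤ hexRadius → dist p x ^ 2 ≤ 4 / 3 := by
    intro x hx
    rw [← hexRadius_sq]
    gcongr
  have k1 := sq a hpa
  have k2 := sq b hpb
  have k3 := sq q hpq
  have n0 := sq_nonneg ‖(a - p) + (b - p) + (q - p)‖
  constructor
  · nlinarith
  · have hz : ‖(a - p) + (b - p) + (q - p)‖ ^ 2 = 0 := by nlinarith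
    have hz' := norm_eq_zero.1 (pow_eq_zero_iff two_ne_zero |>.1 hz)
    have : q = (3 : ℝ) • p - a - b + ((a - p) + (b - p) + (q - p)) := by module
    rw [hz', add_zero] at this
    exact this

theorem latticePoint_one_zero_norm : ‖latticePoint 1 0‖ = 2 := by
  have h := norm_sq_eq_coords (latticePoint 1 0)
  simp only [fstCoord_latticePoint, sndCoord_latticePoint] at h
  nlinarith [norm_nonneg (latticePoint 1 0)]

/-- Leaving a single enlarged disc produces a second one meeting it; leaving both at an intersection
point of their circles produces a third, and the resulting triangle is equilateral of side 2. -/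
theorem exists_dist_eq_two (hS : IsPacking S) (hcov : ∀ p, ∃ s ∈ S, dist p s ≤ hexRadius) :
    ∃ a ∈ S, ∃ b ∈ S, dist a b = 2 := by
  have hr := hexRadius_pos
  obtain ⟨a, ha, -⟩ := hcov 0
  -- a centre `b` at distance at most twice the radius
  obtain ⟨b, hb, hba, hab⟩ : ∃ b ∈ S, b ≠ a ∧ dist a b ≤ 2 * hexRadius := by
    set w : Plane := (hexRadius / 2) • latticePoint 1 0 with hw
    have hwn : ‖w‖ = hexRadius := by
      rw [hw, norm_smul, latticePoint_one_zero_norm, Real.norm_of_nonneg (by positivity)]; ring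
    have hd : dist (a + w) a = hexRadius := by rw [dist_eq_norm, add_sub_cancel_left, hwn]
    have hi : 0 ≤ inner ℝ w (a + w - a) := by
      rw [add_sub_cancel_left]; exact real_inner_self_nonneg
    -- Both discs are taken to be the one around `a`.
    obtain ⟨q, hq, hqa, -, hpq⟩ := exists_third hS hcov
      (norm_pos_iff.1 (by rw [hwn]; exact hr)) hd hd hi hi
    refine ⟨q, hq, hqa, ?_⟩
    linarith [dist_triangle_left a q (a + w)]
  have hab2 := hS.two_le_dist ha hb hba.symm
  -- an intersection point of the circles around `a` and `b`
  set d := dist a b with hd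
  -- Displacing the midpoint of `a` and `b` by k times the vector b - a turned by a right angle
  -- gives squared distance (k² + 1/4)d² = r² to both.
  set k := √(hexRadius ^ 2 / d ^ 2 - 1 / 4) with hk
  have hksq : k ^ 2 * d ^ 2 = hexRadius ^ 2 - d ^ 2 / 4 := by
    rw [hk, Real.sq_sqrt]
    · field_simp
    · rw [sub_nonneg, le_div_iff₀ (by positivity)]
      nlinarith
  have hk0 : 0 ≤ k := Real.sqrt_nonneg _
  set w : Plane := !₂[-(b 1 - a 1), b 0 - a 0] with hw
  have w0 : w 0 = -(b 1 - a 1) := rfl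
  have w1 : w 1 = b 0 - a 0 := rfl
  set p : Plane := (1 / 2 : ℝ) • (a + b) + k • w with hp
  have hdd : (a 0 - b 0) ^ 2 + (a 1 - b 1) ^ 2 = d ^ 2 := by
    rw [hd, EuclideanSpace.dist_eq, Fin.sum_univ_two, Real.sq_sqrt (by positivity)]
    simp only [Real.dist_eq, sq_abs]
  have hwn : ‖w‖ ^ 2 = d ^ 2 := by
    rw [EuclideanSpace.norm_eq, Fin.sum_univ_two, Real.sq_sqrt (by positivity), w0, w1, ← hdd]
    simp only [Real.norm_eq_abs, sq_abs]
    ring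
  have hpx : ∀ x : Plane, x = a ∨ x = b →
      dist p x = hexRadius ∧ 0 ≤ inner ℝ w (p - x) := by
    intro x hx
    have e1 : dist p x ^ 2 = hexRadius ^ 2 := by
      rw [EuclideanSpace.dist_eq, Fin.sum_univ_two, Real.sq_sqrt (by positivity)]
      simp only [Real.dist_eq, sq_abs, hp, PiLp.add_apply, PiLp.smul_apply, smul_eq_mul, w0, w1]
      have : hexRadius ^ 2 = (k ^ 2 + 1 / 4) * ((a 0 - b 0) ^ 2 + (a 1 - b 1) ^ 2) := by
        rw [hdd]; linarith
      rw [this]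
      rcases hx with rfl | rfl <;> ring
    have e2 : inner ℝ w (p - x) = k * d ^ 2 := by
      simp only [PiLp.inner_apply, Fin.sum_univ_two, PiLp.sub_apply, hp, PiLp.add_apply,
        PiLp.smul_apply, smul_eq_mul, w0, w1, RCLike.inner_apply, conj_trivial, ← hdd]
      rcases hx with rfl | rfl <;> ring
    exact ⟨(sq_eq_sq₀ dist_nonneg hr.le).1 e1, by rw [e2]; positivity⟩
  obtain ⟨ha1, ha2⟩ := hpx a (Or.inl rfl)
  obtain ⟨hb1, hb2⟩ := hpx b (Or.inr rfl)
  have hw0 : w ≠ 0 := by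
    intro h
    rw [h, norm_zero] at hwn
    nlinarith
  obtain ⟨q, hq, hqa, hqb, hpq⟩ := exists_third hS hcov hw0 ha1 hb1 ha2 hb2
  exact ⟨a, ha, b, hb, (hS.equilateral ha hb hq hba.symm hqa hqb ha1.le hb1.le hpq).1⟩

/-- At the centre of the expected triangle a third disc is required, and its centre can only be the
missing vertex. -/
theorem add_rotSixty_mem (hS : IsPacking S) (hcov : ∀ p, ∃ s ∈ S, dist p s ≤ hexRadius)
    {a v : Plane} (ha : a ∈ S) (hv : a + v ∈ S) (hn : ‖v‖ = 2) : a + rotSixty v ∈ S := by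
  have hv2 := norm_sq_eq_coords v
  rw [hn] at hv2
  have form : ∀ x : Plane, ‖x‖ ^ 2 =
      4 * (fstCoord x ^ 2 + fstCoord x * sndCoord x + sndCoord x ^ 2) := norm_sq_eq_coords
  set r := rotSixty v with hr
  have hrn : ‖r‖ ^ 2 = 4 := by
    rw [form, hr, fstCoord_rotSixty, sndCoord_rotSixty]
    linarith
  have hrv : ‖r - v‖ ^ 2 = 4 := by
    rw [form, hr, fstCoord_sub, sndCoord_sub, fstCoord_rotSixty, sndCoord_rotSixty]
    linarith
  have hin : inner ℝ r v = 2 := by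
    rw [norm_sub_sq_real, hrn, hn] at hrv
    linarith
  have hin' : inner ℝ v r = 2 := by rw [real_inner_comm]; exact hin
  have hvv : inner ℝ v v = 4 := by rw [real_inner_self_eq_norm_sq, hn]; norm_num
  have hrr : inner ℝ r r = 4 := by rw [real_inner_self_eq_norm_sq, hrn]
  set p := a + (1 / 3 : ℝ) • (v + r) with hp
  have hpa : p - a = (1 / 3 : ℝ) • (v + r) := by rw [hp]; module
  have hpb : p - (a + v) = (1 / 3 : ℝ) • (r - (2 : ℝ) • v) := by rw [hp]; module
  have hda : dist p a = hexRadius := by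
    rw [← sq_eq_sq₀ dist_nonneg hexRadius_pos.le, dist_eq_norm, hpa, hexRadius_sq,
      ← real_inner_self_eq_norm_sq]
    simp only [inner_smul_left, inner_smul_right, inner_add_left, inner_add_right, hin, hin', hvv,
      hrr, conj_trivial]
    norm_num
  have hdb : dist p (a + v) = hexRadius := by
    rw [← sq_eq_sq₀ dist_nonneg hexRadius_pos.le, dist_eq_norm, hpb, hexRadius_sq,
      ← real_inner_self_eq_norm_sq]
    simp only [inner_smul_left, inner_smul_right, inner_sub_left, inner_sub_right, hin, hin', hvv,
      hrr, conj_trivial]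
    norm_num
  -- This direction is orthogonal to `v` and points to the side of the missing vertex, so it leaves
  -- both discs.
  have hwn : (2 : ℝ) • r - v ≠ 0 := by
    intro h
    have : inner ℝ ((2 : ℝ) • r - v) r = 0 := by rw [h, inner_zero_left]
    rw [inner_sub_left, inner_smul_left, hin', hrr] at this
    norm_num at this
  have hav : a ≠ a + v := by
    intro h
    rw [left_eq_add] at h
    rw [h, norm_zero] at hn
    norm_num at hn
  obtain ⟨q, hq, hqa, hqb, hpq⟩ := exists_third hS hcov (w := (2 : ℝ) • r - v) hwn hda hdb
    (by
      rw [hpa]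
      simp only [inner_smul_left, inner_smul_right, inner_sub_left, inner_add_right, hin, hin', hvv,
        hrr, conj_trivial]
      norm_num)
    (by
      rw [hpb]
      simp only [inner_smul_left, inner_smul_right, inner_sub_left, inner_sub_right, hin, hin', hvv,
        hrr, conj_trivial]
      norm_num)
  have := (hS.equilateral ha hv hq hav hqa hqb hda.le hdb.le hpq).2
  have e : (3 : ℝ) • p - a - (a + v) = a + r := by rw [hp]; module
  rwa [this, e] at hq

/-- A packing of unit discs such that the concentric discs of radius `hexRadius` cover the plane is
the hexagonal packing. -/
theorem exists_eq_image_hexagonalPacking (hS : IsPacking S)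
    (hcov : ∀ p, ∃ s ∈ S, dist p s ≤ hexRadius) :
    ∃ e : Plane ≃ᵢ Plane, S = e '' hexagonalPacking := by
  obtain ⟨a, ha, b, hb, hab⟩ := exists_dist_eq_two hS hcov
  obtain ⟨e, he0, he1⟩ := exists_isometryEquiv_of_dist_eq_two hab
  refine ⟨e, ?_⟩
  set T := e ⁻¹' S with hT
  have hTp : IsPacking T := isPacking_of_two_le_dist fun x hx y hy hxy => by
    rw [← e.dist_eq]; exact hS.two_le_dist hx hy (e.injective.ne hxy)
  have hTc : ∀ p, ∃ s ∈ T, dist p s ≤ hexRadius := by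
    intro p
    obtain ⟨s, hs, hps⟩ := hcov (e p)
    refine ⟨e.symm s, ?_, ?_⟩
    · rw [hT, mem_preimage, e.apply_symm_apply]; exact hs
    · rw [← e.dist_eq, e.apply_symm_apply]; exact hps
  have rot : ∀ x ∈ T, ∀ u, ‖u‖ = 2 ∧ x + u ∈ T → ‖rotSixty u‖ = 2 ∧ x + rotSixty u ∈ T := by
    rintro x hx u ⟨hu, hxu⟩
    refine ⟨?_, add_rotSixty_mem hTp hTc hx hxu hu⟩
    have h1 := norm_sq_eq_coords u
    have h2 := norm_sq_eq_coords (rotSixty u)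
    rw [fstCoord_rotSixty, sndCoord_rotSixty] at h2
    rw [hu] at h1
    have : ‖rotSixty u‖ ^ 2 = 2 ^ 2 := by rw [h2, h1]; ring
    exact (sq_eq_sq₀ (norm_nonneg _) zero_le_two).1 this
  have rot' : ∀ x ∈ T, ∀ k : ℕ, ∀ u, ‖u‖ = 2 ∧ x + u ∈ T →
      ‖rotSixty^[k] u‖ = 2 ∧ x + rotSixty^[k] u ∈ T := by
    intro x hx k
    induction k with
    | zero => exact fun u hu => hu
    | succ k ih => exact fun u hu => ih _ (rot x hx u hu)
  -- from a segment one gets to the neighbouring parallel segments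
  have move : ∀ x, x ∈ T → x + latticePoint 1 0 ∈ T → ∀ k j : ℕ,
      rotSixty^[j] (-(rotSixty^[k] (latticePoint 1 0))) = latticePoint 1 0 →
      x + rotSixty^[k] (latticePoint 1 0) ∈ T ∧
        x + rotSixty^[k] (latticePoint 1 0) + latticePoint 1 0 ∈ T := by
    intro x hx hx1 k j hkj
    -- Turn the segment about `x` by k steps to reach the new point, then turn the reversed segment
    -- about that point by j steps until it is parallel to the original one.
    obtain ⟨h1, h2⟩ := rot' x hx k _ ⟨latticePoint_one_zero_norm, hx1⟩
    have h3 := rot' _ h2 j (-(rotSixty^[k] (latticePoint 1 0)))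
      ⟨by rw [norm_neg, h1], by rwa [add_neg_cancel_right]⟩
    rw [hkj] at h3
    exact ⟨h2, h3.2⟩
  have iter : ∀ a b : ℝ, rotSixty (latticePoint a b) = latticePoint (-b) (a + b) := by
    intro a b; simp [rotSixty]
  have neg : ∀ a b : ℝ, -latticePoint a b = latticePoint (-a) (-b) := by
    intro a b; rw [latticePoint, latticePoint]; module
  have add : ∀ a b c d : ℝ, latticePoint a b + latticePoint c d = latticePoint (a + c) (b + d) := by
    intro a b c d; apply coords_ext <;> simp
  have move' : ∀ a b : ℝ, latticePoint a b ∈ T ∧ latticePoint a b + latticePoint 1 0 ∈ T →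
      ∀ c d : ℝ, (∃ k j : ℕ, rotSixty^[k] (latticePoint 1 0) = latticePoint c d ∧
        rotSixty^[j] (latticePoint (-c) (-d)) = latticePoint 1 0) →
      latticePoint (a + c) (b + d) ∈ T ∧ latticePoint (a + c) (b + d) + latticePoint 1 0 ∈ T := by
    rintro a b ⟨h1, h2⟩ c d ⟨k, j, hk, hj⟩
    have := move _ h1 h2 k j (by rw [hk, neg, hj])
    rwa [hk, add] at this
  have d1 : ∃ k j : ℕ, rotSixty^[k] (latticePoint 1 0) = latticePoint 1 0 ∧
      rotSixty^[j] (latticePoint (-1) (-0)) = latticePoint 1 0 :=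
    ⟨0, 3, rfl, by simp only [Function.iterate_succ_apply', Function.iterate_zero_apply, iter]
                   norm_num⟩
  have d2 : ∃ k j : ℕ, rotSixty^[k] (latticePoint 1 0) = latticePoint (-1) 0 ∧
      rotSixty^[j] (latticePoint (-(-1)) (-0)) = latticePoint 1 0 :=
    ⟨3, 0, by simp only [Function.iterate_succ_apply', Function.iterate_zero_apply, iter]
              norm_num, by norm_num⟩
  have d3 : ∃ k j : ℕ, rotSixty^[k] (latticePoint 1 0) = latticePoint 0 1 ∧
      rotSixty^[j] (latticePoint (-0) (-1)) = latticePoint 1 0 :=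
    ⟨1, 2, by simp only [Function.iterate_succ_apply', Function.iterate_zero_apply, iter]
              norm_num,
      by simp only [Function.iterate_succ_apply', Function.iterate_zero_apply, iter]
         norm_num⟩
  have d4 : ∃ k j : ℕ, rotSixty^[k] (latticePoint 1 0) = latticePoint 0 (-1) ∧
      rotSixty^[j] (latticePoint (-0) (-(-1))) = latticePoint 1 0 :=
    ⟨4, 5, by simp only [Function.iterate_succ_apply', Function.iterate_zero_apply, iter]
              norm_num,
      by simp only [Function.iterate_succ_apply', Function.iterate_zero_apply, iter]
         norm_num⟩
  have h00 : latticePoint 0 0 = 0 := by simp [latticePoint]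
  -- The induction carries the unit segment along with the point, since each move starts from a
  -- segment in the fixed direction.
  have all : ∀ m n : ℤ, latticePoint m n ∈ T ∧ latticePoint m n + latticePoint 1 0 ∈ T := by
    intro m n
    induction n using Int.induction_on with
    | zero =>
      induction m using Int.induction_on with
      | zero =>
        rw [Int.cast_zero, h00, zero_add, hT, mem_preimage, mem_preimage, he0, he1]
        exact ⟨ha, hb⟩
      | succ i ih =>
        have := move' _ _ ih _ _ d1
        rw [add_zero] at this
        push_cast at *
        exact this
      | pred i ih =>
        have := move' _ _ ih _ _ d2
        rw [add_zero, ← sub_eq_add_neg] at this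
        push_cast at *
        exact this
    | succ i ih =>
      have := move' _ _ ih _ _ d3
      rw [add_zero] at this
      push_cast at *
      exact this
    | pred i ih =>
      have := move' _ _ ih _ _ d4
      rw [add_zero, ← sub_eq_add_neg] at this
      push_cast at *
      exact this
  have hLT : hexagonalPacking ⊆ T := by
    rintro _ ⟨m, n, rfl⟩
    exact (all m n).1
  -- The lattice is already saturated: every point is within r < 2 of a lattice point, so the
  -- packing has no further centre.
  have hTL : T = hexagonalPacking := by
    refine Subset.antisymm (fun x hx => ?_) hLT
    obtain ⟨y, hy, hxy⟩ := exists_mem_hexagonalPacking_sub_mem x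
    by_contra hne
    have h1 := hTp.two_le_dist hx (hLT hy) (fun h => hne (h ▸ hy))
    have h2 := regularHexagon_subset_closedBall hxy
    rw [mem_closedBall_zero_iff, ← dist_eq_norm] at h2
    linarith [hexRadius_lt]
  rw [← hTL, hT, image_preimage_eq _ e.surjective]

end Covering

/-! ### Rigidity of tilings by convex Kepler blocks and the main theorem -/

/-- The width of the hexagon between opposite edges equals the diameter of the disc; two pairs of
edges determine the centre. -/
theorem eq_zero_of_closedBall_subset_regularHexagon {c : Plane}
    (h : closedBall c 1 ⊆ regularHexagon) : c = 0 := by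
  have key : ∀ s t : ℝ, 4 * (s ^ 2 + s * t + t ^ 2) = 1 → c + latticePoint s t ∈ regularHexagon := by
    intro s t hst
    apply h
    rw [mem_closedBall, dist_eq_norm, add_sub_cancel_left]
    have := norm_sq_eq_coords (latticePoint s t)
    rw [fstCoord_latticePoint, sndCoord_latticePoint, hst] at this
    nlinarith [norm_nonneg (latticePoint s t)]
  have k1 := (mem_regularHexagon.1 (key (1 / 2) 0 (by norm_num))).1
  have k2 := (mem_regularHexagon.1 (key (-1 / 2) 0 (by norm_num))).1
  have k3 := (mem_regularHexagon.1 (key 0 (1 / 2) (by norm_num))).2.1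
  have k4 := (mem_regularHexagon.1 (key 0 (-1 / 2) (by norm_num))).2.1
  simp only [fstCoord_add, sndCoord_add, fstCoord_latticePoint, sndCoord_latticePoint, abs_le]
    at k1 k2 k3 k4
  apply coords_ext
  · rw [show fstCoord 0 = 0 by simp [fstCoord]]; linarith [k1.2, k2.1, k3.2, k4.1]
  · rw [show sndCoord 0 = 0 by simp [sndCoord]]; linarith [k1.2, k2.1, k3.2, k4.1]

/-- The centres of the tiles in a tiling by a convex Kepler building block form a hexagonal
packing. -/
theorem IsTiling.exists_centres_eq {P : Set Plane} {G : Set (Plane ≃ᵢ Plane)} {c : Plane}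
    (hconv : Convex ℝ P) (hP : IsKeplerBlock P) (hG : IsTiling P G) (hc : closedBall c 1 ⊆ P) :
    ∃ e : Plane ≃ᵢ Plane, (fun g : Plane ≃ᵢ Plane => g c) '' G = e '' hexagonalPacking := by
  obtain ⟨e, he⟩ := hP.exists_eq_image_regularHexagon hconv
  -- The given inscribed disc must be the incircle, so every point of a tile is within r of the
  -- image of `c`.
  have hce : c = e 0 := by
    rw [← e.symm_apply_eq]
    apply eq_zero_of_closedBall_subset_regularHexagon
    rw [← e.symm.image_closedBall]
    rintro _ ⟨x, hx, rfl⟩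
    obtain ⟨y, hy, hyx⟩ := he ▸ hc hx
    rw [← hyx, e.symm_apply_apply]
    exact hy
  apply exists_eq_image_hexagonalPacking (hG.isPacking hc)
  intro p
  obtain ⟨g, hg, x, hx, rfl⟩ := mem_iUnion₂.1 (hG.covers ▸ mem_univ p : p ∈ ⋃ g ∈ G, g '' P)
  refine ⟨g c, mem_image_of_mem _ hg, ?_⟩
  rw [he] at hx
  obtain ⟨y, hy, rfl⟩ := hx
  rw [g.dist_eq, hce, e.dist_eq]
  exact regularHexagon_subset_closedBall hy

end CirclePacking

end

theorem mainTheorem5 :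
    -- the hexagonal packing has density `π / √12`, `√12` being the area of the hexagon
    (IsPacking hexagonalPacking ∧
      volume.real regularHexagon = √12 ∧
      HasGlobalDensity hexagonalPacking (Real.pi / √12)) ∧
    -- no packing has a larger global density
    (∀ C : Set Plane, IsPacking C → ∀ x : Plane, upperDensity C x ≤ Real.pi / √12) ∧
    -- `π / √12` is the maximum universal local density, attained by the triangle and the hexagon
    (IsUniversalLocalDensity hexagonalPacking equilateralTriangle (Real.pi / √12) ∧
      IsUniversalLocalDensity hexagonalPacking regularHexagon (Real.pi / √12) ∧
      ∀ (C P : Set Plane) (δ : ℝ), IsPacking C → IsUniversalLocalDensity C P δ →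
        δ ≤ Real.pi / √12) ∧
    -- the regular hexagon is, up to congruence, the only convex Kepler building block
    (∀ P : Set Plane, Convex ℝ P →
      (IsKeplerBlock P ↔ ∃ e : Plane ≃ᵢ Plane, P = e '' regularHexagon)) ∧
    -- tilings by convex Kepler building blocks give only the hexagonal packing
    (∀ (P : Set Plane) (G : Set (Plane ≃ᵢ Plane)) (c : Plane), Convex ℝ P → IsKeplerBlock P →
      IsTiling P G → closedBall c 1 ⊆ P →
        ∃ e : Plane ≃ᵢ Plane, (fun g : Plane ≃ᵢ Plane => g c) '' G = e '' hexagonalPacking) := by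
  refine ⟨⟨isPacking_hexagonalPacking, volume_real_regularHexagon,
    hasGlobalDensity_hexagonalPacking⟩, fun C hC x => hC.upperDensity_le x,
    ⟨isUniversalLocalDensity_equilateralTriangle, isUniversalLocalDensity_regularHexagon,
      fun C P δ hC h => (hasGlobalDensity_of_isUniversalLocalDensity hC h).le hC⟩,
    fun P hconv => ⟨fun hP => hP.exists_eq_image_regularHexagon hconv, ?_⟩,
    fun P G c hconv hP hG hc => hG.exists_centres_eq hconv hP hc⟩
  rintro ⟨e, rfl⟩
  exact isKeplerBlock_image_regularHexagon e
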